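/- **Setting.** A natural join query $Q$ has attributes $A_1,\dots,A_n$ and relation symbols $R\in\mathrm{atoms}(Q)$ with attribute sets $\bar A(R)$; its hypergraph has the attributes as vertices and the sets $\bar A(R)$ as hyperedges. $Q$ is $\alpha$-acyclic if its hypergraph has a tree decomposition all of whose bags are hyperedges; the treewidth is the least value of $\max_s|\mathrm{bag}(s)|-1$ over all tree decompositions. Given a global attribute order, an instance $I$ consists of a finite relation over $\mathbb N$ for each symbol, stored as a search tree in that order; $R[x_1,\dots,x_j]$ denotes the value of the node reached by taking the $x_1$-th branch, then the $x_2$-th branch, and so on. $N$ is the total number of tuples and $Z=|Q(I)|$ the number of output tuples. A certificate for $I$ is a set of comparisons $R[\mathbf x]\,\theta\,S[\mathbf y]$, $\theta\in\{<,=,>\}$, between values on the same attribute, all true in $I$, such that any two instances with search trees of the same shape as those of $I$ that satisfy all these comparisons have the same witnesses (a witness is a choice of one tuple position in each relation such that these tuples together form an output tuple). $|\mathcal C|$ is the least number of comparisons in a certificate for $I$. Minesweeper is the following algorithm. It keeps a tree of constraints $\langle p_1,\dots,p_{i-1},(\ell,r)\rangle$, $p_j\in\mathbb N\cup\{*\}$;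 a constraint rules out all tuples $\mathbf t$ with $t_j=p_j$ whenever $p_j\ne *$ and $\ell<t_i<r$. Repeatedly it asks for a probe point $\mathbf t$ that is not ruled out, and halts if there is none. If $\mathbf t$ is an output tuple, it is output and ruled out; otherwise the gaps around $\mathbf t$ in all relations are found with index lookups and inserted as constraints. The probe point is computed one coordinate at a time in the attribute order, starting at $-1$: given a prefix $(t_1,\dots,t_i)$, the nodes with intervals whose patterns generalize it are listed as $u_1,\dots,u_k$ in any order in which no node is a strict specialization of an earlier one, each $u_j$ gets the shadow $\bar P(u_j)=\bigwedge_{l\ge j}P(u_l)$, and the next free value is found by alternating searches along the chain of shadows, each search inserting the interval it inferred at the shadow node. If there is no free value, then with $p=\bar P(u_1)$ and $p_{i_0}$ its last component that is not $*$, the constraint $\langle p_1,\dots,p_{i_0-1},(p_{i_0}-1,p_{i_0}+1)\rangle$ is inserted and the search resumes with the prefix $(t_1,\dots,t_{i_0-1})$; if all components of $p$ are $*$, there is no probe point. Time is the number of elementary data structure operations. **Proposition.** For every integer $w\ge 2$ there is an $\alpha$-acyclic query $Q_w$ of treewidth $w$ such that for every global attribute order the following hold. 1. There are instances $I_0,I_1,I_2,\dots$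 of $Q_w$ with empty output and $|\mathcal C(I_k)|\to\infty$, and a constant $c>0$, such that for every $k$ Minesweeper has an execution on $I_k$ that halts, and every execution on $I_k$ that halts takes at least $c\,|\mathcal C(I_k)|^w$ steps, whatever linearizations it uses. 2. Consequently a bound of the form $O(|\mathcal C|^{w+1}+Z)$, up to logarithmic factors, is off by at most one in the exponent: if $e,b,K$ are real numbers such that on all instances of $Q_w$ with $|\mathcal C|\ge1$ and $N\ge2$ every execution of Minesweeper that halts takes at most $K\,(|\mathcal C|^e+Z)\,(\log N)^b$ steps, then $e\ge w$. -/

import Mathlib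

namespace Minesweeper

/-! ## Join queries and their hypergraphs -/

/-- A natural join query: `n` attributes, `m` atoms (relation symbols), and the attribute set of
each atom. The global attribute order (GAO) is the order `0 < 1 < ⋯ < n - 1` of `Fin n`; other
attribute orders are obtained with `JoinQuery.reorder`. -/
structure JoinQuery where
  n : ℕ
  m : ℕ
  attrs : Fin m → Finset (Fin n)
  attrs_nonempty : ∀ a, (attrs a).Nonempty
  covered : ∀ v, ∃ a, v ∈ attrs a

/-- The query `Q` with its attributes renamed so that attribute `v` has position `σ v` in the
global attribute order. -/
def JoinQuery.reorder (Q : JoinQuery) (σ : Equiv.Perm (Fin Q.n)) : JoinQuery where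
  n := Q.n
  m := Q.m
  attrs a := (Q.attrs a).map σ.toEmbedding
  attrs_nonempty a := (Q.attrs_nonempty a).map
  covered v := by
    obtain ⟨a, ha⟩ := Q.covered (σ.symm v)
    exact ⟨a, Finset.mem_map.2 ⟨σ.symm v, ha, by simp⟩⟩

/-- The attributes of the atom `a`, listed in the global attribute order. -/
def JoinQuery.pos (Q : JoinQuery) (a : Fin Q.m) : List (Fin Q.n) :=
  (Q.attrs a).sort (· ≤ ·)

/-- A tree decomposition of the hypergraph of `Q`. -/
structure TreeDecomposition (Q : JoinQuery) where
  size : ℕ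
  tree : SimpleGraph (Fin size)
  isTree : tree.IsTree
  bag : Fin size → Finset (Fin Q.n)
  edge_subset : ∀ a, ∃ s, Q.attrs a ⊆ bag s
  connected : ∀ v, (tree.induce {s | v ∈ bag s}).Connected

/-- `Q` is α-acyclic: some tree decomposition has only hyperedges as bags (a join tree). -/
def JoinQuery.AlphaAcyclic (Q : JoinQuery) : Prop :=
  ∃ D : TreeDecomposition Q, ∀ s, ∃ a, D.bag s = Q.attrs a

/-- The treewidth: the least `k` such that some tree decomposition has all bags of size at
most `k + 1`. -/
noncomputable def JoinQuery.treewidth (Q : JoinQuery) : ℕ :=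
  sInf {k | ∃ D : TreeDecomposition Q, ∀ s, (D.bag s).card ≤ k + 1}

/-! ## Relations as search trees, instances -/

/-- The children of a node of the search tree of the relation `R`. A node is named by the list `p`
of the values on the path from the root, and `children R p` is the set of the values that
come next in the tuples of `R` that start with `p`. -/
def children (R : Finset (List ℕ)) (p : List ℕ) : Finset ℕ :=
  (R.filter (fun r => p <+: r ∧ p.length < r.length)).image (fun r => r.getD p.length 0)

/-- Starting from the node `p`, follow the index tuple `x`, where the entry `i` selects the `i`-th
smallest child (counted from `0`). The result is the list of values met from the root on, or
`none` if some index is out of range. -/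
def descend (R : Finset (List ℕ)) (p : List ℕ) : List ℕ → Option (List ℕ)
  | [] => some p
  | i :: x =>
    match ((children R p).sort (· ≤ ·))[i]? with
    | none => none
    | some c => descend R (p ++ [c]) x

/-- A database instance for `Q`: each atom gets a finite relation over `ℕ`. The columns of each
relation are in the global attribute order. -/
structure Instance (Q : JoinQuery) where
  rel : Fin Q.m → Finset (List ℕ)
  rel_length : ∀ a, ∀ r ∈ rel a, r.length = (Q.attrs a).card

namespace Instance

variable {Q : JoinQuery}

/-- The output `Q(I)` of the natural join. -/
def output (I : Instance Q) : Set (Fin Q.n → ℕ) :=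
  {t | ∀ a, (Q.pos a).map t ∈ I.rel a}

/-- The input size: the total number of tuples. -/
def inputSize (I : Instance Q) : ℕ := ∑ a, (I.rel a).card

/-- The values `(R[x₁], R[x₁,x₂], …, R[x])` for the relation `R` of the atom `a`; it is `none` if
`x` is not an index tuple of `R`. -/
def values (I : Instance Q) (a : Fin Q.m) (x : List ℕ) : Option (List ℕ) :=
  descend (I.rel a) [] x

/-- The value `R[x]` of a variable. -/
def value (I : Instance Q) (a : Fin Q.m) (x : List ℕ) : Option ℕ :=
  (I.values a x).bind List.getLast?

/-- `J` instantiates the same variables as `I`: the search trees have the same shape. -/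
def SameShape (I J : Instance Q) : Prop :=
  ∀ a x, (I.values a x).isSome ↔ (J.values a x).isSome

/-- `X` chooses a full index tuple in every relation, and they all contribute to one tuple
of the output. -/
def IsWitness (I : Instance Q) (X : Fin Q.m → List ℕ) : Prop :=
  ∃ t ∈ I.output, ∀ a, I.values a (X a) = some ((Q.pos a).map t)

end Instance

/-! ## Certificates -/

/-- A symbolic comparison `R[x] θ S[y]`, where `R`, `S` are the relations of the atoms `a`, `b`
and `θ` is one of `<`, `=`, `>`. -/
structure Comparison (Q : JoinQuery) where
  a : Fin Q.m
  x : List ℕ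
  θ : Ordering
  b : Fin Q.m
  y : List ℕ

/-- `R[x]` and `S[y]` are variables of the instance `I`, on the same attribute. -/
def Comparison.Valid {Q : JoinQuery} (c : Comparison Q) (I : Instance Q) : Prop :=
  c.x ≠ [] ∧ c.y ≠ [] ∧ (I.values c.a c.x).isSome ∧ (I.values c.b c.y).isSome ∧
    (Q.pos c.a)[c.x.length - 1]? = (Q.pos c.b)[c.y.length - 1]?

/-- The comparison is true in `J`. -/
def Comparison.Holds {Q : JoinQuery} (c : Comparison Q) (J : Instance Q) : Prop :=
  ∃ u v, J.value c.a c.x = some u ∧ J.value c.b c.y = some v ∧ compare u v = c.θ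

/-- `A` is a certificate for the input instance `I`: a set of comparisons between variables
of `I`, true in `I`, such that any two instances of the same shape that satisfy all of
them have the same witnesses. -/
def IsCertificate {Q : JoinQuery} (I : Instance Q) (A : Finset (Comparison Q)) : Prop :=
  (∀ c ∈ A, c.Valid I) ∧ (∀ c ∈ A, c.Holds I) ∧
    ∀ J K : Instance Q, I.SameShape J → I.SameShape K →
      (∀ c ∈ A, c.Holds J) → (∀ c ∈ A, c.Holds K) →
        ∀ X, J.IsWitness X ↔ K.IsWitness X

/-- The size `|𝒞|` of an optimal certificate. -/
noncomputable def Instance.certSize {Q : JoinQuery} (I : Instance Q) : ℕ :=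
  sInf {k | ∃ A, IsCertificate I A ∧ A.card = k}

/-! ## The constraint data structure -/

/-- A pattern: `some c` is an equality component and `none` is the wildcard `*`. -/
abbrev Pattern := List (Option ℤ)

/-- `p.Specializes q`: same length, and `p` agrees with `q` at the equality components of `q`. -/
def Pattern.Specializes (p q : Pattern) : Prop :=
  List.Forall₂ (fun b c : Option ℤ => c = none ∨ c = b) p q

/-- The meet of two patterns with a common specialization. -/
def Pattern.meet (p q : Pattern) : Pattern := List.zipWith Option.or p q

/-- An open interval `(lo, hi)`, where `lo` may be `-∞` and `hi` may be `+∞`. -/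
structure Interval where
  lo : WithBot ℤ
  hi : WithTop ℤ

def Interval.Mem (J : Interval) (y : ℤ) : Prop :=
  J.lo < (y : WithBot ℤ) ∧ (y : WithTop ℤ) < J.hi

/-- `lo < hi`; otherwise the interval is empty and there is nothing to store. -/
def Interval.Proper (J : Interval) : Prop :=
  ∀ l r : ℤ, J.lo = l → J.hi = r → l < r

/-- A constraint tree. A node is named by the pattern of labels on the path from the root to it;
`T p = none` means that there is no node `p`, and `T p = some L` means that the node `p`
exists and `L` is its list of intervals. -/
abbrev CDS := Pattern → Option (List Interval)

namespace CDS

/-- The initial data structure: a root without intervals. -/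
def init : CDS := fun p => if p = [] then some [] else none

def intervals (T : CDS) (p : Pattern) : List Interval := (T p).getD []

/-- Some interval of the node `p` covers `y`. -/
def Covers (T : CDS) (p : Pattern) (y : ℤ) : Prop := ∃ J ∈ T.intervals p, J.Mem y

/-- `y` is the answer of `p.intervals.Next(x)`: the smallest `y ≥ x` that no interval of the node
`p` covers, and `+∞` if there is none. -/
def IsNext (T : CDS) (p : Pattern) (x y : WithTop ℤ) : Prop :=
  IsLeast {z : WithTop ℤ | x ≤ z ∧ ∀ b : ℤ, z = b → ¬ T.Covers p b} y

open Classical in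
/-- Create the node `p` if it does not exist. -/
noncomputable def touch (T : CDS) (p : Pattern) : CDS :=
  fun q => if q = p ∧ T p = none then some [] else T q

open Classical in
/-- Insert the interval `J` at the node `p`, and delete the subtrees of the children of `p` whose
labels lie in `J`. -/
noncomputable def insertAt (T : CDS) (p : Pattern) (J : Interval) : CDS := fun q =>
  if q = p then (if J.Proper then some (J :: T.intervals p) else T p)
  else if ∃ c : ℤ, J.Mem c ∧ (p ++ [some c]) <+: q then none
  else T q

open Classical in
/-- Continue the insertion of a constraint from the node `p`: the remaining components before
the interval are the third argument. The insertion stops early if the constraint turns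
out to be subsumed. -/
noncomputable def insertFrom (T : CDS) (p : Pattern) : Pattern → Interval → CDS
  | [], J => T.insertAt p J
  | c :: q, J =>
    if ∃ a : ℤ, c = some a ∧ T.Covers p a then T
    else insertFrom (T.touch (p ++ [c])) (p ++ [c]) q J

/-- `InsConstraint(⟨p, J⟩)`. -/
noncomputable def insert (T : CDS) (p : Pattern) (J : Interval) : CDS := T.insertFrom [] p J

/-- `InsConstraint(⟨p, (x - 1, y)⟩)`, where the interval is empty if `x = +∞`. -/
noncomputable def insertGap (T : CDS) (p : Pattern) : WithTop ℤ → WithTop ℤ → CDS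
  | ⊤, _ => T
  | (x : ℤ), y => T.insert p ⟨((x - 1 : ℤ) : WithBot ℤ), y⟩

end CDS

/-! ## `getProbePoint`

Procedures are given by their big-step semantics. `P T x T' y k` means that `P`, called with data
structure `T` and argument `x`, may return `y` after `k` steps, with the data structure
changed to `T'`. One step is charged for each call of `Next`, `InsConstraint` and `FindGap`,
for each iteration of the loop of `getProbePoint`, for each shadow node, and for each
output tuple. -/

abbrev Procedure := CDS → WithTop ℤ → CDS → WithTop ℤ → ℕ → Prop

/-- The loop `repeat z ← up(y); y ← here(z) until y = z; return y`. -/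
inductive RepeatUntil (up here : Procedure) : Procedure
  | done {T T₁ T₂ : CDS} {y z : WithTop ℤ} {k₁ k₂ : ℕ} :
      up T y T₁ z k₁ → here T₁ z T₂ z k₂ → RepeatUntil up here T y T₂ z (k₁ + k₂)
  | again {T T₁ T₂ T₃ : CDS} {y z y' r : WithTop ℤ} {k₁ k₂ k₃ : ℕ} :
      up T y T₁ z k₁ → here T₁ z T₂ y' k₂ → y' ≠ z → RepeatUntil up here T₂ y' T₃ r k₃ →
        RepeatUntil up here T y T₃ r (k₁ + k₂ + k₃)

/-- `u.intervals.Next`. -/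
def next (u : Pattern) : Procedure := fun T x T' y k => T' = T ∧ T.IsNext u x y ∧ k = 1

/-- `nextChainVal(·, u, G)`, where the list is the part of the chain `G` from `u` upwards. -/
def nextChainVal : List Pattern → Procedure
  | [] => fun _ _ _ _ _ => False
  | [u] => next u
  | u :: v :: G => fun T x T' y k =>
      ∃ T₁ k₁, RepeatUntil (nextChainVal (v :: G)) (next u) T x T₁ y k₁ ∧
        T' = T₁.insertGap u x y ∧ k = k₁ + 1

/-- `nextChainVal(·, s, {s, u})` for a node `u` and its shadow `s`. -/
def nextPairVal (s u : Pattern) : Procedure :=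
  if s = u then nextChainVal [u] else nextChainVal [s, u]

/-- `nextShadowChainVal`; the list is the part of the shadow chain from the current node upwards,
and its entries are pairs (shadow of `u`, `u`). -/
def nextShadowChainVal : List (Pattern × Pattern) → Procedure
  | [] => fun _ _ _ _ _ => False
  | [s] => nextPairVal s.1 s.2
  | s :: s' :: G => fun T x T' y k =>
      ∃ T₁ k₁, RepeatUntil (nextShadowChainVal (s' :: G)) (nextPairVal s.1 s.2) T x T₁ y k₁ ∧
        T' = T₁.insertGap s.1 x y ∧ k = k₁ + 1

/-- `lin` lists the nodes that have intervals and whose patterns generalize the prefix `t`, in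
an order in which no node is a strict specialization of an earlier one. -/
def IsLinearization (T : CDS) (t : List ℤ) (lin : List Pattern) : Prop :=
  lin.Nodup ∧
  (∀ p, p ∈ lin ↔ Pattern.Specializes (t.map some) p ∧ T.intervals p ≠ []) ∧
  lin.Pairwise (fun p q => ¬ Pattern.Specializes q p)

/-- Each node of the linearization with its shadow: the meet of it and all later nodes. -/
def shadows : List Pattern → List (Pattern × Pattern)
  | [] => []
  | u :: us => (us.foldl Pattern.meet u, u) :: shadows us

open Classical in
/-- Create the missing shadow nodes, with the interval `(-∞, 0)`. -/
noncomputable def addShadows (T : CDS) (L : List (Pattern × Pattern)) : CDS :=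
  L.foldl (fun T s => if T s.1 = none then T.insert s.1 ⟨⊥, ((0 : ℤ) : WithTop ℤ)⟩ else T) T

/-- `L` is the shadow chain of a linearization, sorted from the bottom upwards; ties are broken
arbitrarily. -/
def IsShadowChain (lin : List Pattern) (L : List (Pattern × Pattern)) : Prop :=
  L.Perm (shadows lin) ∧ L.Pairwise (fun s s' => Pattern.Specializes s.1 s'.1)

/-- `getProbePoint` for `n` attributes: from the data structure `T` and the prefix `t`, it may
return the second to last argument (`none` for null). A call starts with the empty prefix.
The linearization is arbitrary each time. -/
inductive GetProbePoint (n : ℕ) : CDS → List ℤ → CDS → Option (List ℤ) → ℕ → Prop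
  | found {T : CDS} {t : List ℤ} : t.length = n → GetProbePoint n T t T (some t) 0
  | free {T T' : CDS} {t : List ℤ} {r : Option (List ℤ)} {k : ℕ} :
      t.length < n → IsLinearization T t [] →
      GetProbePoint n T (t ++ [-1]) T' r k → GetProbePoint n T t T' r (k + 1)
  | advance {T T₁ T' : CDS} {t : List ℤ} {lin : List Pattern} {s : Pattern × Pattern}
      {L : List (Pattern × Pattern)} {y : ℤ} {r : Option (List ℤ)} {k₁ k : ℕ} :
      t.length < n → IsLinearization T t lin → IsShadowChain lin (s :: L) →
      nextShadowChainVal (s :: L) (addShadows T (shadows lin)) ((-1 : ℤ) : WithTop ℤ)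
        T₁ (y : WithTop ℤ) k₁ →
      GetProbePoint n T₁ (t ++ [y]) T' r k →
      GetProbePoint n T t T' r (lin.length + k₁ + 1 + k)
  | backtrack {T T₁ T' : CDS} {t : List ℤ} {lin : List Pattern} {s : Pattern × Pattern}
      {L : List (Pattern × Pattern)} {q : Pattern} {c : ℤ} {j : ℕ}
      {r : Option (List ℤ)} {k₁ k : ℕ} :
      t.length < n → IsLinearization T t lin → IsShadowChain lin (s :: L) →
      nextShadowChainVal (s :: L) (addShadows T (shadows lin)) ((-1 : ℤ) : WithTop ℤ)
        T₁ ⊤ k₁ →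
      s.1 = q ++ some c :: List.replicate j none →
      GetProbePoint n
        (T₁.insert q ⟨((c - 1 : ℤ) : WithBot ℤ), ((c + 1 : ℤ) : WithTop ℤ)⟩)
        (t.take q.length) T' r k →
      GetProbePoint n T t T' r (lin.length + k₁ + 2 + k)
  | null {T T₁ : CDS} {t : List ℤ} {lin : List Pattern} {s : Pattern × Pattern}
      {L : List (Pattern × Pattern)} {k₁ : ℕ} :
      t.length < n → IsLinearization T t lin → IsShadowChain lin (s :: L) →
      nextShadowChainVal (s :: L) (addShadows T (shadows lin)) ((-1 : ℤ) : WithTop ℤ)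
        T₁ ⊤ k₁ →
      s.1 = List.replicate t.length none →
      GetProbePoint n T t T₁ none (lin.length + k₁ + 1)

/-! ## The outer algorithm -/

/-- The lower end of the gap that `FindGap` finds around `v` below the node `p`: the largest
child `≤ v`, or `-∞`. -/
def gapLo (R : Finset (List ℕ)) (p : List ℕ) (v : ℤ) : WithBot ℕ :=
  ((children R p).filter (fun c : ℕ => (c : ℤ) ≤ v)).max

/-- The upper end of the gap: the smallest child `≥ v`, or `+∞`. -/
def gapHi (R : Finset (List ℕ)) (p : List ℕ) (v : ℤ) : WithTop ℕ :=
  ((children R p).filter (fun c : ℕ => v ≤ (c : ℤ))).min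

def gapInterval (R : Finset (List ℕ)) (p : List ℕ) (v : ℤ) : Interval where
  lo := (gapLo R p v).map (fun c : ℕ => (c : ℤ))
  hi := (gapHi R p v).map (fun c : ℕ => (c : ℤ))

/-- The nodes at depth `j` that are explored around the values `v 0, v 1, …` of the probe point
on the attributes of `R`, one for each vector in `{ℓ, h}^j` without out-of-range index. -/
def exploredNodes (R : Finset (List ℕ)) (v : ℕ → ℤ) : ℕ → List (List ℕ)
  | 0 => [[]]
  | j + 1 => (exploredNodes R v j).flatMap (fun p =>
      ((WithBot.recBotCoe [] (fun c => [p ++ [c]]) (gapLo R p (v j)) : List (List ℕ)) ++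
       (WithTop.recTopCoe [] (fun c => [p ++ [c]]) (gapHi R p (v j)) : List (List ℕ))))

/-- The pattern, of length `len`, with equality components `p` at the attributes `s` and
wildcards elsewhere. -/
def gapPattern (s : List ℕ) (p : List ℕ) (len : ℕ) : Pattern :=
  (List.range len).map (fun i => ((s.zip p).lookup i).map (fun c : ℕ => (c : ℤ)))

/-- The constraints found around the probe point `t`, in the order of discovery; there is one for
each call of `FindGap`. -/
def gapConstraints {Q : JoinQuery} (I : Instance Q) (t : List ℤ) : List (Pattern × Interval) :=
  (List.finRange Q.m).flatMap (fun a =>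
    let s : List ℕ := (Q.pos a).map (fun i => (i : ℕ))
    let v : ℕ → ℤ := fun j => t.getD (s.getD j 0) 0
    (List.range s.length).flatMap (fun j =>
      (exploredNodes (I.rel a) v j).map (fun p =>
        (gapPattern s p (s.getD j 0), gapInterval (I.rel a) p (v j)))))

/-- The integer list form of a tuple of the output space. -/
def tupleList {n : ℕ} (τ : Fin n → ℕ) : List ℤ := List.ofFn (fun i => (τ i : ℤ))

/-- `RunFrom I T out k`: started with the data structure `T`, the main loop of Minesweeper on the
instance `I` may halt after `k` steps, having output the tuples `out`. -/
inductive RunFrom {Q : JoinQuery} (I : Instance Q) : CDS → List (Fin Q.n → ℕ) → ℕ → Prop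
  | halt {T T' : CDS} {k : ℕ} : GetProbePoint Q.n T [] T' none k → RunFrom I T [] k
  | output {T T' : CDS} {τ : Fin Q.n → ℕ} {t : List ℤ} {c : ℤ} {out : List (Fin Q.n → ℕ)}
      {k k' : ℕ} :
      GetProbePoint Q.n T [] T' (some (tupleList τ)) k → τ ∈ I.output →
      tupleList τ = t ++ [c] →
      RunFrom I (T'.insert (t.map some)
        ⟨((c - 1 : ℤ) : WithBot ℤ), ((c + 1 : ℤ) : WithTop ℤ)⟩) out k' →
      RunFrom I T (τ :: out) (k + (gapConstraints I (tupleList τ)).length + 2 + k')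
  | explore {T T' : CDS} {t : List ℤ} {out : List (Fin Q.n → ℕ)} {k k' : ℕ} :
      GetProbePoint Q.n T [] T' (some t) k → (∀ τ ∈ I.output, tupleList τ ≠ t) →
      RunFrom I ((gapConstraints I t).foldl (fun T c => T.insert c.1 c.2) T') out k' →
      RunFrom I T out (k + 2 * (gapConstraints I t).length + k')

/-- Some execution of Minesweeper on the instance `I` halts after `k` steps with output `out`. -/
def Run {Q : JoinQuery} (I : Instance Q) (out : List (Fin Q.n → ℕ)) (k : ℕ) : Prop :=
  RunFrom I CDS.init out k

end Minesweeper

namespace Minesweeper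

/-! ## Patterns -/

namespace Pattern

/-! Let `Q_w` have as atoms all pairs of its `w + 1` attributes, together with one atom on all
attributes. The full atom makes the query α-acyclic and forces treewidth `w`; the pairs make it
symmetric, so every attribute order looks the same. Let `v` be the last attribute in the order. In
the grid instance all relations are products: the first `w` attributes range over `{0, …, m - 1}`,
the last over `{0, …, w - 1}`, except that the atom `{i, v}` misses the value `i`. The output is
empty because the value `c` of `v` is refused by the atom `{c, v}`. The certificate size is of order
`m`. Comparing every value of `v` in the pair relations with those below the branches `0` takes at
most `w ^ 4 * m` comparisons and forbids any output (`exists_isCertificate_gridInstance`).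
Conversely, a branch that no comparison mentions can be changed so that an output tuple appears
(`le_of_isCertificate_gridInstance`). Minesweeper needs `m ^ w` steps. A gap that excludes the value
`i` of `v` comes from the atom `{i, v}`, so its pattern fixes attribute `i` (`derived_gap`). This
property passes to specializations, and the searches only infer what follows from it
(`soundAt_nextShadowChainVal`). A node at which all values of `v` are excluded therefore fixes all
`w` earlier attributes, and backtracking from it excludes a single grid point. Backtracking at a
higher level only collects points that are excluded already. So each step excludes at most one new
point, and all `m ^ w` must be excluded before there is no probe point (`GetProbePoint.derived`). No
choice of linearization enters this argument. The lower bound would be vacuous without a halting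
execution. One exists because all constants and finite right ends stay bounded, and every
backtracking step and every exploration rules out a new prefix in a finite box
(`GetProbePoint.exists`, `Run.exists`). The second claim follows by letting `m` grow, since the
input size is polynomial in `m` (`le_exponent`). -/

theorem Specializes.length_eq {p q : Pattern} (h : Specializes p q) : p.length = q.length :=
  List.Forall₂.length_eq h

theorem Specializes.refl (p : Pattern) : Specializes p p :=
  List.forall₂_same.2 fun _ _ => Or.inr rfl

theorem specializes_cons {b c : Option ℤ} {p q : Pattern} :
    Specializes (b :: p) (c :: q) ↔ (c = none ∨ c = b) ∧ Specializes p q :=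
  List.forall₂_cons

theorem specializes_nil_left {q : Pattern} : Specializes [] q ↔ q = [] :=
  List.forall₂_nil_left_iff

theorem specializes_nil_right {p : Pattern} : Specializes p [] ↔ p = [] :=
  List.forall₂_nil_right_iff

theorem Specializes.trans : ∀ {p q r : Pattern},
    Specializes p q → Specializes q r → Specializes p r
  | [], _, _, h, h' => by
    rw [specializes_nil_left] at h; subst h; exact h'
  | _ :: _, [], _, h, _ => by simp [specializes_nil_right] at h
  | _ :: _, _ :: _, [], _, h' => by simp [specializes_nil_right] at h'
  | a :: p, b :: q, c :: r, h, h' => by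
    rw [specializes_cons] at *
    refine ⟨?_, h.2.trans h'.2⟩
    rcases h'.1 with h1 | h1
    · exact Or.inl h1
    · subst h1; exact h.1

theorem Specializes.getElem? {p q : Pattern} (h : Specializes p q) {i : ℕ} {c : ℤ}
    (hq : q[i]? = some (some c)) : p[i]? = some (some c) := by
  induction h generalizing i with
  | nil => simp at hq
  | cons h1 _ ih =>
    cases i with
    | zero =>
      simp only [List.getElem?_cons_zero, Option.some.injEq] at hq ⊢
      rcases h1 with h1 | h1
      · simp [h1] at hq
      · rw [← h1, hq]
    | succ i => simpa using ih (by simpa using hq)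

theorem Specializes.take {p q : Pattern} (h : Specializes p q) (i : ℕ) :
    Specializes (List.take i p) (List.take i q) :=
  List.forall₂_take i h

theorem Specializes.eq_of_map_some {p : Pattern} : ∀ {l : List ℤ},
    Specializes p (l.map some) → p = l.map some
  | [], h => specializes_nil_right.1 h
  | a :: l, h => by
    cases p with
    | nil => simp [specializes_nil_left] at h
    | cons b p =>
      rw [List.map_cons, specializes_cons] at h
      rcases h with ⟨h1 | h1, h2⟩
      · simp at h1
      · rw [List.map_cons, h1, h2.eq_of_map_some]

/-- Two patterns with a common specialization never disagree where both have equality components, so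
choosing the first available component respects both. -/
theorem specializes_meet : ∀ {r p q : Pattern}, Specializes r p → Specializes r q →
    Specializes r (meet p q) ∧ Specializes (meet p q) p ∧ Specializes (meet p q) q
  | [], p, q, h, h' => by
    rw [specializes_nil_left] at h h'
    subst h h'
    simp [meet, specializes_nil_left]
  | a :: r, [], _, h, _ => by simp [specializes_nil_right] at h
  | a :: r, _, [], _, h => by simp [specializes_nil_right] at h
  | a :: r, b :: p, c :: q, h, h' => by
    rw [specializes_cons] at h h'
    obtain ⟨i1, i2, i3⟩ := specializes_meet h.2 h'.2
    have e : meet (b :: p) (c :: q) = (b.or c) :: meet p q := rfl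
    rw [e, specializes_cons, specializes_cons, specializes_cons]
    refine ⟨⟨?_, i1⟩, ⟨?_, i2⟩, ⟨?_, i3⟩⟩
    · cases b with
      | none => simpa using h'.1
      | some b => simpa using h.1
    · cases b with
      | none => simp
      | some b => simp
    · cases b with
      | none => simp
      | some b =>
        cases c with
        | none => simp
        | some c =>
          right
          have h1 := h.1
          have h2 := h'.1
          simp only [reduceCtorEq, false_or] at h1 h2
          rw [h2, ← h1]; rfl

/-- All the equality components of `p` are at most `B`. -/
def Below (B : ℤ) (p : Pattern) : Prop := ∀ c : ℤ, some c ∈ p → c ≤ B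

theorem Below.meet {B : ℤ} : ∀ {p q : Pattern}, Below B p → Below B q → Below B (meet p q)
  | [], _, _, _ => by intro c hc; simp [Pattern.meet] at hc
  | _ :: _, [], _, _ => by intro c hc; simp [Pattern.meet] at hc
  | a :: p, b :: q, hp, hq => by
    intro c hc
    have e : Pattern.meet (a :: p) (b :: q) = (a.or b) :: Pattern.meet p q := rfl
    rw [e, List.mem_cons] at hc
    rcases hc with hc | hc
    · cases a with
      | none => exact hq c (by simpa using Or.inl hc)
      | some a => exact hp c (by simpa using Or.inl hc)
    · exact Below.meet (fun c h => hp c (List.mem_cons_of_mem _ h))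
        (fun c h => hq c (List.mem_cons_of_mem _ h)) c hc

/-- The patterns that generalize a given one, more special patterns first. -/
def generalizations : List ℤ → List Pattern
  | [] => [[]]
  | a :: t => (generalizations t).map (some a :: ·) ++ (generalizations t).map (none :: ·)

theorem mem_generalizations {p : Pattern} : ∀ {t : List ℤ},
    p ∈ generalizations t ↔ Specializes (t.map some) p
  | [] => by simp [generalizations, specializes_nil_left]
  | a :: t => by
    cases p with
    | nil => simp [generalizations, specializes_nil_right]
    | cons b p =>
      simp only [generalizations, List.mem_append, List.mem_map, List.cons.injEq,
        List.map_cons, specializes_cons, mem_generalizations]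
      constructor
      · rintro (⟨q, hq, rfl, rfl⟩ | ⟨q, hq, rfl, rfl⟩)
        · exact ⟨Or.inr rfl, hq⟩
        · exact ⟨Or.inl rfl, hq⟩
      · rintro ⟨rfl | rfl, h⟩
        · exact Or.inr ⟨p, h, rfl, rfl⟩
        · exact Or.inl ⟨p, h, rfl, rfl⟩

theorem nodup_generalizations : ∀ t : List ℤ, (generalizations t).Nodup
  | [] => by simp [generalizations]
  | a :: t => by
    have ih := nodup_generalizations t
    refine List.Nodup.append (ih.map fun _ _ h => (List.cons.inj h).2)
      (ih.map fun _ _ h => (List.cons.inj h).2) ?_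
    intro x hx hx'
    simp only [List.mem_map] at hx hx'
    obtain ⟨_, _, rfl⟩ := hx
    obtain ⟨_, _, h⟩ := hx'
    simp at h

/-- Of two listed patterns, the earlier has an equality component at the first position where they
differ and the later a wildcard, so the later cannot specialize the earlier. -/
theorem pairwise_generalizations : ∀ t : List ℤ,
    (generalizations t).Pairwise fun p q => ¬ Specializes q p
  | [] => by simp [generalizations]
  | a :: t => by
    have ih := pairwise_generalizations t
    refine List.pairwise_append.2 ⟨?_, ?_, ?_⟩
    · exact List.pairwise_map.2 (ih.imp fun h h' => h (specializes_cons.1 h').2)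
    · exact List.pairwise_map.2 (ih.imp fun h h' => h (specializes_cons.1 h').2)
    · intro p hp q hq h
      simp only [List.mem_map] at hp hq
      obtain ⟨_, _, rfl⟩ := hp
      obtain ⟨_, _, rfl⟩ := hq
      simp [specializes_cons] at h

end Pattern

open Pattern

/-! ## Shadows -/

theorem foldl_meet {r u : Pattern} {us : List Pattern} (hu : Specializes r u)
    (hus : ∀ p ∈ us, Specializes r p) :
    Specializes r (us.foldl meet u) ∧ Specializes (us.foldl meet u) u ∧
      ∀ p ∈ us, Specializes (us.foldl meet u) p := by
  induction us generalizing u with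
  | nil => simpa using ⟨hu, Specializes.refl u⟩
  | cons v us ih =>
    obtain ⟨h1, h2, h3⟩ := specializes_meet hu (hus v (by simp))
    obtain ⟨i1, i2, i3⟩ := ih h1 fun p hp => hus p (by simp [hp])
    refine ⟨i1, i2.trans h2, ?_⟩
    intro p hp
    rcases List.mem_cons.1 hp with rfl | hp
    · exact i2.trans h3
    · exact i3 p hp

/-- A sorted list of pairs of a shadow and a node that generalizes it. -/
def IsChain (L : List (Pattern × Pattern)) : Prop :=
  L.Pairwise (fun s s' => Pattern.Specializes s.1 s'.1) ∧ ∀ s ∈ L, Pattern.Specializes s.1 s.2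

/-- Later shadows are meets of fewer nodes, hence more general. So the shadows come out sorted in
the order of the linearization itself. -/
theorem shadows_spec {r : Pattern} {lin : List Pattern} (h : ∀ p ∈ lin, Specializes r p) :
    IsChain (shadows lin) ∧ ∀ s ∈ shadows lin, Specializes r s.1 := by
  induction lin with
  | nil => simp [shadows, IsChain]
  | cons u us ih =>
    obtain ⟨⟨i1, i2⟩, i3⟩ := ih fun p hp => h p (by simp [hp])
    obtain ⟨f1, f2, f3⟩ := foldl_meet (h u (by simp)) fun p (hp : p ∈ us) => h p (by simp [hp])
    refine ⟨⟨List.pairwise_cons.2 ⟨?_, i1⟩, ?_⟩, ?_⟩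
    -- The shadow of the head specializes all later nodes, hence every meet of them.
    · have key : ∀ vs : List Pattern, (∀ p ∈ vs, Specializes (us.foldl meet u) p) →
          ∀ s ∈ shadows vs, Specializes (us.foldl meet u) s.1 := by
        intro vs
        induction vs with
        | nil => simp [shadows]
        | cons v vs ihv =>
          intro hv s hs
          rcases List.mem_cons.1 hs with rfl | hs
          · exact (foldl_meet (hv v (by simp)) fun p hp => hv p (by simp [hp])).1
          · exact ihv (fun p hp => hv p (by simp [hp])) s hs
      exact key us f3
    · intro s hs
      rcases List.mem_cons.1 hs with rfl | hs
      · exact f2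
      · exact i2 s hs
    · intro s hs
      rcases List.mem_cons.1 hs with rfl | hs
      · exact f1
      · exact i3 s hs

theorem mem_shadows_snd {lin : List Pattern} {u : Pattern} (hu : u ∈ lin) :
    ∃ s ∈ shadows lin, s.2 = u := by
  induction lin with
  | nil => simp at hu
  | cons v us ih =>
    rcases List.mem_cons.1 hu with rfl | hu
    · exact ⟨_, by simp [shadows]; left; rfl, rfl⟩
    · obtain ⟨s, hs, h⟩ := ih hu
      exact ⟨s, by simp [shadows, hs], h⟩

theorem below_shadows {B : ℤ} {lin : List Pattern} (h : ∀ p ∈ lin, Below B p) :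
    ∀ s ∈ shadows lin, Below B s.1 := by
  induction lin with
  | nil => simp [shadows]
  | cons u us ih =>
    intro s hs
    rcases List.mem_cons.1 hs with rfl | hs
    · have key : ∀ (vs : List Pattern) (v : Pattern), Below B v → (∀ p ∈ vs, Below B p) →
          Below B (vs.foldl meet v) := by
        intro vs
        induction vs with
        | nil => intro v hv _; exact hv
        | cons v' vs ihv =>
          intro v hv hvs
          exact ihv _ (hv.meet (hvs v' (by simp))) fun p hp => hvs p (by simp [hp])
      exact key us u (h u (by simp)) fun p hp => h p (by simp [hp])
    · exact ih (fun p hp => h p (by simp [hp])) s hs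

theorem IsShadowChain.isChain {r : Pattern} {lin : List Pattern} {L : List (Pattern × Pattern)}
    (h : IsShadowChain lin L) (hlin : ∀ p ∈ lin, Specializes r p) :
    IsChain L ∧ ∀ s ∈ L, Specializes r s.1 := by
  obtain ⟨⟨_, h2⟩, h3⟩ := shadows_spec hlin
  exact ⟨⟨h.2, fun s hs => h2 s (h.1.mem_iff.1 hs)⟩, fun s hs => h3 s (h.1.mem_iff.1 hs)⟩

/-- The list `generalizations t` is already in an admissible order, and filtering keeps it so. -/
theorem exists_linearization (T : CDS) (t : List ℤ) : ∃ lin, IsLinearization T t lin := by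
  classical
  refine ⟨(generalizations t).filter fun p => T.intervals p ≠ [],
    (nodup_generalizations t).filter _, ?_, (pairwise_generalizations t).filter _⟩
  intro p
  simp [mem_generalizations]

theorem Interval.Mem.proper {J : Interval} {y : ℤ} (h : J.Mem y) : J.Proper := by
  intro l r hl hr
  rw [Interval.Mem, hl, hr] at h
  have h1 := WithBot.coe_lt_coe.1 h.1
  have h2 := WithTop.coe_lt_coe.1 h.2
  omega

/-! ## Insertion of constraints -/

namespace CDS

theorem intervals_touch (T : CDS) (p q : Pattern) : (T.touch p).intervals q = T.intervals q := by
  simp only [touch, intervals]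
  split_ifs with h
  · rw [h.1, h.2]; rfl
  · rfl

/-- Deleting subtrees and stopping early only lose intervals. This one-sided bound is all that the
soundness arguments need. -/
theorem mem_intervals_insertFrom {T : CDS} {p q r : Pattern} {J J' : Interval}
    (h : J' ∈ (T.insertFrom p q J).intervals r) :
    J' ∈ T.intervals r ∨ (r = p ++ q ∧ J' = J) := by
  induction q generalizing T p with
  | nil =>
    simp only [insertFrom, insertAt, intervals] at h
    rw [List.append_nil]
    split_ifs at h with h1 h2 h3
    · simp only [Option.getD_some, List.mem_cons] at h
      rcases h with h | h
      · exact Or.inr ⟨h1, h⟩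
      · left; rw [h1]; exact h
    · left; rw [h1]; exact h
    · simp at h
    · exact Or.inl h
  | cons c q ih =>
    simp only [insertFrom] at h
    split_ifs at h with h1
    · exact Or.inl h
    · rcases ih h with h | h
      · left; rwa [intervals_touch] at h
      · right; simpa using h

theorem mem_intervals_insert {T : CDS} {p r : Pattern} {J J' : Interval}
    (h : J' ∈ (T.insert p J).intervals r) : J' ∈ T.intervals r ∨ (r = p ∧ J' = J) :=
  mem_intervals_insertFrom h

theorem covers_of_covers_insert {T : CDS} {p r : Pattern} {J : Interval} {y : ℤ}
    (h : (T.insert p J).Covers r y) : T.Covers r y ∨ (r = p ∧ J.Mem y) := by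
  obtain ⟨J', h1, h2⟩ := h
  rcases mem_intervals_insert h1 with h1 | ⟨h3, rfl⟩
  · exact Or.inl ⟨J', h1, h2⟩
  · exact Or.inr ⟨h3, h2⟩

/-- The constraint `⟨p, J⟩` rules out the prefix `t`. -/
def RulesOut (p : Pattern) (J : Interval) (t : List ℤ) : Prop :=
  ∃ y, Specializes ((t.take p.length).map some) p ∧ t[p.length]? = some y ∧ J.Mem y

/-- Some constraint of `T` rules out the prefix `t`. -/
def Rules (T : CDS) (t : List ℤ) : Prop :=
  ∃ p, ∃ J ∈ T.intervals p, RulesOut p J t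

theorem rules_iff {T : CDS} {t : List ℤ} : T.Rules t ↔ ∃ p y,
    Specializes ((t.take p.length).map some) p ∧ t[p.length]? = some y ∧ T.Covers p y := by
  constructor
  · rintro ⟨p, J, hJ, y, h1, h2, h3⟩; exact ⟨p, y, h1, h2, J, hJ, h3⟩
  · rintro ⟨p, y, h1, h2, J, hJ, h3⟩; exact ⟨p, J, hJ, y, h1, h2, h3⟩

theorem specializes_prefix {t : List ℤ} {p q : Pattern}
    (h : Specializes ((t.take p.length).map some) p) (hq : q <+: p) :
    Specializes ((t.take q.length).map some) q := by
  have h1 := h.take q.length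
  rw [← List.map_take, List.take_take, min_eq_left hq.length_le,
    ← List.prefix_iff_eq_take.1 hq] at h1
  exact h1

/-- Insertion never loses information: whatever is deleted, or not inserted because of an early
stop, is implied by an interval that is present afterwards. -/
theorem rules_insertFrom {T : CDS} {p q : Pattern} {J : Interval} {t : List ℤ} :
    (T.Rules t → (T.insertFrom p q J).Rules t) ∧
      (RulesOut (p ++ q) J t → (T.insertFrom p q J).Rules t) := by
  induction q generalizing T p with
  | nil =>
    have key : RulesOut p J t → (T.insertAt p J).Rules t := by
      intro h
      refine ⟨p, J, ?_, h⟩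
      obtain ⟨y, _, _, hy⟩ := h
      simp [insertAt, intervals, Interval.Mem.proper hy]
    constructor
    · rintro ⟨r, J', hJ', hr⟩
      simp only [insertFrom]
      by_cases h1 : r = p
      · refine ⟨r, J', ?_, hr⟩
        subst h1
        simp only [insertAt, intervals, if_true]
        split_ifs
        · simp only [Option.getD_some, List.mem_cons]; right; exact hJ'
        · exact hJ'
      -- A deleted node lies below a label `c` in `J`. A prefix that it rules out has the value `c`
      -- there, so the new interval rules it out.
      · by_cases h2 : ∃ c : ℤ, J.Mem c ∧ (p ++ [some c]) <+: r
        · obtain ⟨c, hc, hpre⟩ := h2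
          apply key
          obtain ⟨y, hy, _, _⟩ := hr
          obtain ⟨s, hs⟩ := hpre
          have hl : r.length = p.length + 1 + s.length := by rw [← hs]; simp; omega
          refine ⟨c, ?_, ?_, hc⟩
          · exact specializes_prefix hy ⟨[some c] ++ s, by rw [← hs, List.append_assoc]⟩
          · have h3 : r[p.length]? = some (some c) := by rw [← hs]; simp
            have h4 := hy.getElem? h3
            rw [List.getElem?_map, List.getElem?_take] at h4
            rw [if_pos (by omega)] at h4
            simpa using h4
        · refine ⟨r, J', ?_, hr⟩
          simp only [insertAt, intervals, if_neg h1, if_neg h2]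
          exact hJ'
    · rw [List.append_nil]; exact key
  | cons c q ih =>
    simp only [insertFrom]
    split_ifs with h1
    -- The insertion stopped at a label that is already covered, and that covering interval rules
    -- out the prefix.
    · refine ⟨id, ?_⟩
      rintro ⟨y, hy, _, _⟩
      obtain ⟨a, rfl, J', hJ', hm⟩ := h1
      refine ⟨p, J', hJ', a, ?_, ?_, hm⟩
      · exact specializes_prefix hy ⟨some a :: q, rfl⟩
      · have h4 := hy.getElem? (i := p.length) (c := a) (by simp)
        rw [List.getElem?_map, List.getElem?_take] at h4
        rw [if_pos (by simp)] at h4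
        simpa using h4
    · have := ih (T := T.touch (p ++ [c])) (p := p ++ [c])
      constructor
      · rintro ⟨r, J', hJ', hr⟩
        exact this.1 ⟨r, J', by rwa [intervals_touch], hr⟩
      · intro h
        exact this.2 (by simpa using h)

theorem Rules.insert {T : CDS} {t : List ℤ} (h : T.Rules t) (p : Pattern) (J : Interval) :
    (T.insert p J).Rules t := rules_insertFrom.1 h

theorem rules_insert {T : CDS} {t : List ℤ} {p : Pattern} {J : Interval} (h : RulesOut p J t) :
    (T.insert p J).Rules t := rules_insertFrom.2 h

end CDS

/-! ## Soundness of the inferred intervals -/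

theorem CDS.covers_insertGap {T : CDS} {p r : Pattern} {x y : WithTop ℤ} {v : ℤ}
    (h : (T.insertGap p x y).Covers r v) :
    T.Covers r v ∨ (r = p ∧ x ≤ (v : WithTop ℤ) ∧ (v : WithTop ℤ) < y) := by
  cases x with
  | top => exact Or.inl h
  | coe x =>
    rcases CDS.covers_of_covers_insert h with h | ⟨h1, h2, h3⟩
    · exact Or.inl h
    · refine Or.inr ⟨h1, ?_, h3⟩
      have := WithBot.coe_lt_coe.1 h2
      exact WithTop.coe_le_coe.2 (by omega)

theorem CDS.covers_addShadows {T : CDS} {L : List (Pattern × Pattern)} {p : Pattern} {v : ℤ}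
    (h : (addShadows T L).Covers p v) : T.Covers p v ∨ (v < 0 ∧ ∃ s ∈ L, s.1 = p) := by
  induction L generalizing T with
  | nil => exact Or.inl h
  | cons s L ih =>
    simp only [addShadows, List.foldl_cons] at h
    rcases ih h with h | ⟨h1, s', h2, h3⟩
    · split_ifs at h
      · rcases CDS.covers_of_covers_insert h with h | ⟨h1, _, h3⟩
        · exact Or.inl h
        · exact Or.inr ⟨WithTop.coe_lt_coe.1 h3, s, by simp, h1.symm⟩
      · exact Or.inl h
    · exact Or.inr ⟨h1, s', by simp [h2], h3⟩

/-- Every value that `T` covers satisfies `Φ`. -/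
def CDS.Within (T : CDS) (Φ : Pattern → ℤ → Prop) : Prop := ∀ p v, T.Covers p v → Φ p v

/-- Under the invariant `Φ`, the procedure `P` skips only values `v` with `Φ u v`. -/
def Procedure.SoundAt (Φ : Pattern → ℤ → Prop) (u : Pattern) (P : Procedure) : Prop :=
  ∀ T x T' y k, CDS.Within T Φ → P T x T' y k →
    CDS.Within T' Φ ∧ ∀ v : ℤ, x ≤ (v : WithTop ℤ) → (v : WithTop ℤ) < y → Φ u v

section Sound

variable {Φ : Pattern → ℤ → Prop} {u : Pattern}

theorem soundAt_next : Procedure.SoundAt Φ u (next u) := by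
  rintro T x T' y k hT ⟨rfl, hy, _⟩
  refine ⟨hT, fun v h1 h2 => ?_⟩
  by_contra hv
  have : (v : WithTop ℤ) ∈ {z : WithTop ℤ | x ≤ z ∧ ∀ b : ℤ, z = b → ¬ T'.Covers u b} := by
    refine ⟨h1, fun b hb hc => hv ?_⟩
    rw [WithTop.coe_inj.1 hb]
    exact hT _ _ hc
  exact absurd (hy.2 this) (not_le.2 h2)

/-- In each round the skipped values split into those below `z`, skipped by `up`, those from `z` to
`y'`, skipped by `here`, and those left to the later rounds. -/
theorem soundAt_repeatUntil {up here : Procedure} (h1 : Procedure.SoundAt Φ u up)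
    (h2 : Procedure.SoundAt Φ u here) : Procedure.SoundAt Φ u (RepeatUntil up here) := by
  intro T x T' y k hT h
  induction h with
  | done ha hb =>
    obtain ⟨a1, a2⟩ := h1 _ _ _ _ _ hT ha
    obtain ⟨b1, b2⟩ := h2 _ _ _ _ _ a1 hb
    exact ⟨b1, a2⟩
  | @again T T₁ T₂ T₃ y z y' r k₁ k₂ k₃ ha hb _ _ ih =>
    obtain ⟨a1, a2⟩ := h1 _ _ _ _ _ hT ha
    obtain ⟨b1, b2⟩ := h2 _ _ _ _ _ a1 hb
    obtain ⟨c1, c2⟩ := ih b1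
    refine ⟨c1, fun v hv hv' => ?_⟩
    rcases lt_or_ge (v : WithTop ℤ) z with h | h
    · exact a2 v hv h
    · rcases lt_or_ge (v : WithTop ℤ) y' with h' | h'
      · exact b2 v h h'
      · exact c2 v h' hv'

/-- The interval inserted at `u` contains exactly the values just skipped, and these satisfy `Φ u`.
-/
theorem soundAt_insertGap {P P' : Procedure} (h : Procedure.SoundAt Φ u P)
    (hP : ∀ T x T' y k, P' T x T' y k → ∃ T₁ k₁, P T x T₁ y k₁ ∧ T' = T₁.insertGap u x y) :
    Procedure.SoundAt Φ u P' := by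
  intro T x T' y k hT h'
  obtain ⟨T₁, k₁, h1, rfl⟩ := hP _ _ _ _ _ h'
  obtain ⟨a1, a2⟩ := h _ _ _ _ _ hT h1
  refine ⟨fun p v hv => ?_, a2⟩
  rcases CDS.covers_insertGap hv with hv | ⟨rfl, hv1, hv2⟩
  · exact a1 p v hv
  · exact a2 v hv1 hv2

variable (hΦ : ∀ p p' v, Specializes p p' → Φ p' v → Φ p v)
include hΦ

theorem Procedure.SoundAt.mono {u' : Pattern} {P : Procedure} (h : Procedure.SoundAt Φ u P)
    (hu : Pattern.Specializes u' u) : Procedure.SoundAt Φ u' P := by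
  intro T x T' y k hT hP
  obtain ⟨h1, h2⟩ := h _ _ _ _ _ hT hP
  exact ⟨h1, fun v hv hv' => hΦ _ _ _ hu (h2 v hv hv')⟩

theorem soundAt_nextPairVal {s : Pattern} (h : Pattern.Specializes s u) :
    Procedure.SoundAt Φ s (nextPairVal s u) := by
  unfold nextPairVal
  split_ifs with hs
  · subst hs; exact soundAt_next
  · refine soundAt_insertGap (P := RepeatUntil (nextChainVal [u]) (next s)) ?_ ?_
    · exact soundAt_repeatUntil ((soundAt_next (u := u)).mono hΦ h) soundAt_next
    · rintro T x T' y k ⟨T₁, k₁, h1, h2, _⟩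
      exact ⟨T₁, k₁, h1, h2⟩

/-- Each search up the chain is sound at a more general shadow. Since `Φ` passes to specializations,
it is also sound at the shadow below, where the result is stored. -/
theorem soundAt_nextShadowChainVal : ∀ {s : Pattern × Pattern} {L : List (Pattern × Pattern)},
    IsChain (s :: L) → Procedure.SoundAt Φ s.1 (nextShadowChainVal (s :: L))
  | s, [], h => soundAt_nextPairVal hΦ (h.2 s (by simp))
  | s, s' :: L, h => by
    have ih := soundAt_nextShadowChainVal (s := s') (L := L)
      ⟨(List.pairwise_cons.1 h.1).2, fun r hr => h.2 r (by simp [List.mem_cons.1 hr])⟩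
    refine soundAt_insertGap
      (P := RepeatUntil (nextShadowChainVal (s' :: L)) (nextPairVal s.1 s.2)) ?_ ?_
    · exact soundAt_repeatUntil (ih.mono hΦ ((List.pairwise_cons.1 h.1).1 s' (by simp)))
        (soundAt_nextPairVal hΦ (h.2 s (by simp)))
    · rintro T x T' y k ⟨T₁, k₁, h1, h2, _⟩
      exact ⟨T₁, k₁, h1, h2⟩

end Sound

/-! ## The number of backtracking steps -/

/-- A point of the grid `{0, …, m - 1} ^ w` as a list of integers. -/
def gridList {w m : ℕ} (a : Fin w → Fin m) : List ℤ := List.ofFn fun i => ((a i : ℕ) : ℤ)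

theorem gridList_injective {w m : ℕ} : Function.Injective (gridList (w := w) (m := m)) := by
  intro a b h
  have := List.ofFn_injective h
  funext i
  have := congrFun this i
  exact Fin.ext (by exact_mod_cast this)

@[simp] theorem length_gridList {w m : ℕ} (a : Fin w → Fin m) : (gridList a).length = w := by
  simp [gridList]

/-- A constraint on the last attribute that covers a value `i < w` has an equality component at
the attribute `i`, and a constraint on another attribute that covers a value below `m` has no
wildcards and rules out only prefixes of points of `E`. -/
def Derived {w m : ℕ} (E : Finset (Fin w → Fin m)) (p : Pattern) (v : ℤ) : Prop :=
  (p.length = w → ∀ i : ℕ, i < w → v = i → p[i]? ≠ some none) ∧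
  (p.length < w → ∀ c : ℕ, c < m → v = c → ∃ l : List ℤ, p = l.map some ∧
    ∀ a : Fin w → Fin m, l ++ [v] <+: gridList a → a ∈ E)

section Derived

variable {w m : ℕ} {E : Finset (Fin w → Fin m)}

/-- Equality components survive specialization, and a pattern without wildcards has no
specialization other than itself. -/
theorem derived_of_specializes (p p' : Pattern) (v : ℤ) (h : Pattern.Specializes p p')
    (h' : Derived E p' v) : Derived E p v := by
  have hl := h.length_eq
  refine ⟨fun hp i hi hv hc => ?_, fun hp c hc hv => ?_⟩
  · have h1 := h'.1 (hl ▸ hp) i hi hv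
    have hi' : i < p'.length := by omega
    cases h2 : p'[i] with
    | none => exact h1 (by rw [List.getElem?_eq_getElem hi', h2])
    | some d =>
      have := h.getElem? (i := i) (c := d) (by rw [List.getElem?_eq_getElem hi', h2])
      rw [this] at hc
      simp at hc
  · obtain ⟨l, rfl, hE⟩ := h'.2 (hl ▸ hp) c hc hv
    exact ⟨l, h.eq_of_map_some, hE⟩

theorem Derived.mono {E' : Finset (Fin w → Fin m)} (h : E ⊆ E') {p : Pattern} {v : ℤ}
    (hp : Derived E p v) : Derived E' p v := by
  refine ⟨hp.1, fun h1 c hc hv => ?_⟩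
  obtain ⟨l, hl, hE⟩ := hp.2 h1 c hc hv
  exact ⟨l, hl, fun a ha => h (hE a ha)⟩

theorem derived_of_neg {p : Pattern} {v : ℤ} (h : v < 0) : Derived E p v :=
  ⟨fun _ _ _ hv => by omega, fun _ _ _ hv => by omega⟩

theorem exists_eq_map_some {p : Pattern} (h : none ∉ p) : ∃ l : List ℤ, p = l.map some := by
  induction p with
  | nil => exact ⟨[], rfl⟩
  | cons a p ih =>
    obtain ⟨l, rfl⟩ := ih fun h' => h (List.mem_cons_of_mem _ h')
    cases a with
    | none => simp at h
    | some a => exact ⟨a :: l, rfl⟩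

/-- On the last attribute, the excluded value `i` forces an equality component at `i`, for each `i <
w`. On an earlier attribute the excluded value `0` suffices; it is a grid value because `m > 0`. -/
theorem none_notMem_of_derived (hm : 0 < m) {p : Pattern} (hp : p.length ≤ w)
    (h : ∀ v : ℤ, -1 ≤ v → Derived E p v) : none ∉ p := by
  intro hn
  rcases hp.lt_or_eq with hp | hp
  · obtain ⟨l, rfl, _⟩ := (h 0 (by omega)).2 hp 0 hm rfl
    simp at hn
  · obtain ⟨i, hi, hpi⟩ := List.mem_iff_getElem.1 hn
    exact (h i (by omega)).1 hp i (by omega) rfl (by rw [List.getElem?_eq_getElem hi, hpi])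

/-- The coordinate of `a` that follows `l` is one of the values excluded at `l`, and such an
exclusion only concerns points of `E`. -/
theorem mem_of_derived {l : List ℤ} (hl : l.length < w)
    (h : ∀ v : ℤ, -1 ≤ v → Derived E (l.map some) v) {a : Fin w → Fin m}
    (ha : l <+: gridList a) : a ∈ E := by
  obtain ⟨l', h1, h2⟩ := (h (a ⟨l.length, hl⟩ : ℕ) (by omega)).2 (by simpa using hl)
    (a ⟨l.length, hl⟩) (a _).2 rfl
  have : l' = l := (List.map_injective_iff.2 (Option.some_injective _) h1).symm
  subst this
  apply h2
  obtain ⟨s, hs⟩ := ha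
  have hg : (gridList a)[l'.length]? = some ((a ⟨l'.length, hl⟩ : ℕ) : ℤ) := by
    simp [gridList, hl]
  cases s with
  | nil => rw [← hs] at hg; simp at hg
  | cons b s =>
    rw [← hs] at hg
    simp at hg
    exact ⟨s, by rw [← hs, hg]; simp⟩

/-- New shadow nodes exclude only negative values, so they do not disturb the invariant. As the
search starts at `-1`, the answer `⊤` means that all values from `-1` on are excluded at the bottom
shadow. -/
theorem derived_chain {T T₁ : CDS} {t : List ℤ} {lin : List Pattern}
    {s : Pattern × Pattern} {L : List (Pattern × Pattern)} {y : WithTop ℤ} {k : ℕ}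
    (hlin : IsLinearization T t lin) (hL : IsShadowChain lin (s :: L))
    (h : nextShadowChainVal (s :: L) (addShadows T (shadows lin)) ((-1 : ℤ) : WithTop ℤ) T₁ y k)
    (hT : T.Within (Derived E)) :
    T₁.Within (Derived E) ∧ s.1.length = t.length ∧
      (y = ⊤ → ∀ v : ℤ, -1 ≤ v → Derived E s.1 v) := by
  obtain ⟨h1, h2⟩ := hL.isChain (r := t.map some) fun p hp => ((hlin.2.1 p).1 hp).1
  have hT' : (addShadows T (shadows lin)).Within (Derived E) := by
    intro p v hv
    rcases CDS.covers_addShadows hv with hv | ⟨hv, _⟩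
    · exact hT p v hv
    · exact derived_of_neg hv
  obtain ⟨h3, h4⟩ := soundAt_nextShadowChainVal derived_of_specializes h1 _ _ _ _ _ hT' h
  refine ⟨h3, by simpa using (h2 s (by simp)).length_eq.symm, ?_⟩
  rintro rfl v hv
  exact h4 v (WithTop.coe_le_coe.2 hv) (WithTop.coe_lt_top v)

/-- Each step adds at most one point to the set of excluded grid points, and there is no probe point
only when all points are excluded. -/
theorem GetProbePoint.derived (hm : 0 < m) (hw : 0 < w) {T T' : CDS} {t : List ℤ}
    {r : Option (List ℤ)} {k : ℕ} (h : GetProbePoint (w + 1) T t T' r k)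
    (hT : T.Within (Derived E)) :
    ∃ E' : Finset (Fin w → Fin m), T'.Within (Derived E') ∧ E'.card ≤ E.card + k ∧
      (r = none → E' = Finset.univ) := by
  induction h generalizing E with
  | found _ => exact ⟨E, hT, by omega, by simp⟩
  | free _ _ _ ih =>
    obtain ⟨E', h1, h2, h3⟩ := ih hT
    exact ⟨E', h1, by omega, h3⟩
  | advance _ hlin hL hc _ ih =>
    obtain ⟨E', h1, h2, h3⟩ := ih (derived_chain hlin hL hc hT).1
    exact ⟨E', h1, by omega, h3⟩
  | @backtrack T T₁ T' t lin s L q c j r k₁ k ht hlin hL hc hs _ ih =>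
    obtain ⟨d1, d2, d3⟩ := derived_chain hlin hL hc hT
    have hlen : s.1.length ≤ w := by omega
    have hn := none_notMem_of_derived hm hlen (d3 rfl)
    obtain ⟨l, rfl⟩ := exists_eq_map_some (p := q) fun h' => hn (by rw [hs]; simp [h'])
    -- The shadow has no wildcards, so the backtracking removes exactly its last component.
    have hj : j = 0 := by
      by_contra hj
      exact hn (by rw [hs]; simp [hj])
    subst hj
    have hs' : s.1 = (l ++ [c]).map some := by rw [hs]; simp
    rw [hs'] at d3 hlen
    simp only [List.length_map, List.length_append, List.length_cons, List.length_nil] at hlen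
    -- This adds the one grid point `l ++ [c]` if that list has length `w`, and nothing if it is
    -- shorter.
    set E' := E ∪ Finset.univ.filter fun a => gridList a = l ++ [c] with hE'
    have hcard : E'.card ≤ E.card + 1 := by
      refine (Finset.card_union_le _ _).trans (Nat.add_le_add_left ?_ _)
      refine Finset.card_le_one.2 fun a ha b hb => gridList_injective ?_
      rw [(Finset.mem_filter.1 ha).2, (Finset.mem_filter.1 hb).2]
    obtain ⟨E'', h1, h2, h3⟩ := ih (E := E') (by
      intro p v hv
      rcases CDS.covers_of_covers_insert hv with hv | ⟨rfl, hv1, hv2⟩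
      · exact (d1 p v hv).mono Finset.subset_union_left
      · have hv : v = c := by
          have h1 := WithBot.coe_lt_coe.1 hv1
          have h2 := WithTop.coe_lt_coe.1 hv2
          omega
        subst hv
        refine ⟨fun h' => by simp at h'; omega, fun _ _ _ _ => ⟨l, rfl, fun a ha => ?_⟩⟩
        -- Above the last level, all values are excluded at `l ++ [v]`, so every grid point that
        -- extends it is already in `E`.
        rcases Nat.lt_or_ge (l.length + 1) w with hl | hl
        · exact Finset.mem_union_left _
            (mem_of_derived (l := l ++ [v]) (by simpa using hl) (d3 rfl) ha)
        · refine Finset.mem_union_right _ (Finset.mem_filter.2 ⟨Finset.mem_univ _, ?_⟩)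
          exact (ha.eq_of_length (by simp; omega)).symm)
    exact ⟨E'', h1, by omega, h3⟩
  | @null T T₁ t lin s L k₁ ht hlin hL hc hs =>
    obtain ⟨d1, d2, d3⟩ := derived_chain hlin hL hc hT
    refine ⟨E, d1, by omega, fun _ => ?_⟩
    have hn := none_notMem_of_derived hm (by omega) (d3 rfl)
    -- A pattern that consists of wildcards and contains none is empty, so all values of the first
    -- attribute are excluded at the root.
    have ht0 : t.length = 0 := by
      by_contra h0
      exact hn (by rw [hs]; simp [h0])
    rw [hs, ht0] at d3
    refine Finset.eq_univ_of_forall fun a => ?_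
    exact mem_of_derived (l := []) (by simpa using hw) (d3 rfl) (List.nil_prefix)

/-- A run that halts without output takes at least as many steps as there are grid points. -/
theorem RunFrom.pow_le (hm : 0 < m) (hw : 0 < w) {Q : JoinQuery} (hn : Q.n = w + 1)
    {I : Instance Q} (hI : I.output = ∅)
    (hgap : ∀ t, ∀ c ∈ gapConstraints I t, ∀ v, c.2.Mem v →
      Derived (∅ : Finset (Fin w → Fin m)) c.1 v)
    {T : CDS} {out : List (Fin Q.n → ℕ)} {k : ℕ} (h : RunFrom I T out k)
    (hT : T.Within (Derived E)) : m ^ w ≤ E.card + k := by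
  induction h generalizing E with
  | halt h =>
    rw [hn] at h
    obtain ⟨E', _, h2, h3⟩ := h.derived hm hw hT
    rw [h3 rfl] at h2
    simpa using h2
  | output _ h => rw [hI] at h; exact absurd h (Set.notMem_empty _)
  | @explore T T' t out k k' h _ _ ih =>
    rw [hn] at h
    obtain ⟨E', h1, h2, _⟩ := h.derived hm hw hT
    have key : ∀ (L : List (Pattern × Interval)) (T : CDS), T.Within (Derived E') →
        (∀ c ∈ L, ∀ v, c.2.Mem v → Derived (∅ : Finset (Fin w → Fin m)) c.1 v) →
        (L.foldl (fun T c => T.insert c.1 c.2) T).Within (Derived E') := by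
      intro L
      induction L with
      | nil => intro T hT _; exact hT
      | cons c L ihL =>
        intro T hT hL
        refine ihL _ (fun p v hv => ?_) fun c hc => hL c (by simp [hc])
        rcases CDS.covers_of_covers_insert hv with hv | ⟨rfl, hv'⟩
        · exact hT p v hv
        · exact (hL c (by simp) v hv').mono (Finset.empty_subset _)
    have := ih (key _ _ h1 (hgap t))
    omega

theorem Run.pow_le (hm : 0 < m) (hw : 0 < w) {Q : JoinQuery} (hn : Q.n = w + 1)
    {I : Instance Q} (hI : I.output = ∅)
    (hgap : ∀ t, ∀ c ∈ gapConstraints I t, ∀ v, c.2.Mem v →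
      Derived (∅ : Finset (Fin w → Fin m)) c.1 v)
    {out : List (Fin Q.n → ℕ)} {k : ℕ} (h : Run I out k) : m ^ w ≤ k := by
  have := RunFrom.pow_le (E := ∅) hm hw hn hI hgap h ?_
  · simpa using this
  · rintro p v ⟨J, hJ, _⟩
    unfold CDS.intervals CDS.init at hJ
    split_ifs at hJ <;> simp at hJ

end Derived

/-! ## Termination -/

/-- Patterns and right ends of intervals in `T` are bounded in terms of `B`. -/
def CDS.Bounded (B : ℤ) (T : CDS) : Prop :=
  ∀ p, ∀ J ∈ T.intervals p, Below B p ∧ ∀ r : ℤ, J.hi = r → r ≤ B + 1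

/-- The values that a search can meet. -/
def InRange (B : ℤ) (x : WithTop ℤ) : Prop :=
  x = ⊤ ∨ ∃ b : ℤ, x = b ∧ -1 ≤ b ∧ b ≤ B + 1

theorem CDS.Bounded.insert {B : ℤ} {T : CDS} (hT : T.Bounded B) {p : Pattern} {J : Interval}
    (hp : Below B p) (hJ : ∀ r : ℤ, J.hi = r → r ≤ B + 1) : (T.insert p J).Bounded B := by
  intro q J' h
  rcases CDS.mem_intervals_insert h with h | ⟨rfl, rfl⟩
  · exact hT q J' h
  · exact ⟨hp, hJ⟩

theorem CDS.bounded_insertGap {B : ℤ} {T : CDS} (hT : T.Bounded B) {p : Pattern}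
    (hp : Below B p) {x y : WithTop ℤ} (hy : InRange B y) : (T.insertGap p x y).Bounded B := by
  cases x with
  | top => exact hT
  | coe x =>
    refine hT.insert hp fun r hr => ?_
    rcases hy with rfl | ⟨b, rfl, _, hb⟩
    · simp at hr
    · have := WithTop.coe_inj.1 hr
      omega

theorem CDS.bounded_addShadows {B : ℤ} (hB : 0 ≤ B) {L : List (Pattern × Pattern)}
    (hL : ∀ s ∈ L, Below B s.1) {T : CDS} (hT : T.Bounded B) : (addShadows T L).Bounded B := by
  induction L generalizing T with
  | nil => exact hT
  | cons s L ih =>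
    refine ih (fun r hr => hL r (by simp [hr])) ?_
    dsimp only
    split_ifs
    · refine hT.insert (hL s (by simp)) fun r hr => ?_
      have := WithTop.coe_inj.1 hr
      omega
    · exact hT

theorem CDS.Rules.addShadows {t : List ℤ} {L : List (Pattern × Pattern)} {T : CDS}
    (h : T.Rules t) : (addShadows T L).Rules t := by
  induction L generalizing T with
  | nil => exact h
  | cons s L ih =>
    refine ih ?_
    dsimp only
    split_ifs
    · exact h.insert _ _
    · exact h

theorem CDS.Rules.insertGap {t : List ℤ} {T : CDS} (h : T.Rules t) (p : Pattern)
    (x y : WithTop ℤ) : (T.insertGap p x y).Rules t := by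
  cases x with
  | top => exact h
  | coe x => exact h.insert _ _

/-- From every data structure, the procedure can return a value that is not covered at the
nodes `N`, and it inserts only intervals below this value at the nodes `S`. -/
def Procedure.Total (B : ℤ) (S N : Set Pattern) (P : Procedure) : Prop :=
  ∀ T x, CDS.Bounded B T → InRange B x → ∃ T' y k, P T x T' y k ∧ CDS.Bounded B T' ∧
    InRange B y ∧ x ≤ y ∧
    (∀ p (v : ℤ), CDS.Covers T' p v → CDS.Covers T p v ∨ (p ∈ S ∧ (v : WithTop ℤ) < y)) ∧
    (∀ p ∈ N, ∀ v : ℤ, y = v → ¬ CDS.Covers T' p v) ∧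
    ∀ t, CDS.Rules T t → CDS.Rules T' t

/-! ### The searches can always return -/

section Total

variable {B : ℤ} {S N N' : Set Pattern}

/-- An interval that covers `B + 1` cannot have a finite right end, so it also covers everything
beyond. Hence the next free value is at most `B + 1` or infinite. -/
theorem CDS.exists_isNext {T : CDS} (hT : T.Bounded B) (u : Pattern) {x : WithTop ℤ}
    (hx : InRange B x) : ∃ y, T.IsNext u x y ∧ InRange B y := by
  rcases hx with rfl | ⟨a, rfl, ha, ha'⟩
  · exact ⟨⊤, ⟨⟨le_rfl, fun b hb => by simp at hb⟩, fun z hz => hz.1⟩, Or.inl rfl⟩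
  by_cases h : ∃ b : ℤ, a ≤ b ∧ ¬ T.Covers u b
  · obtain ⟨b, ⟨hb1, hb2⟩, hb3⟩ := Int.exists_least_of_bdd
      (P := fun b => a ≤ b ∧ ¬ T.Covers u b) ⟨a, fun z hz => hz.1⟩ h
    refine ⟨b, ⟨⟨WithTop.coe_le_coe.2 hb1, fun c hc => ?_⟩, fun z hz => ?_⟩,
      Or.inr ⟨b, rfl, by omega, ?_⟩⟩
    · rw [← WithTop.coe_inj.1 hc]; exact hb2
    · cases z with
      | top => exact le_top
      | coe z =>
        exact WithTop.coe_le_coe.2 (hb3 z ⟨WithTop.coe_le_coe.1 hz.1, hz.2 z rfl⟩)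
    · by_contra hb
      have hc : T.Covers u (B + 1) := by
        by_contra hc
        have := hb3 (B + 1) ⟨ha', hc⟩
        omega
      obtain ⟨J, hJ, h1, h2⟩ := hc
      refine hb2 ⟨J, hJ, h1.trans (WithBot.coe_lt_coe.2 (by omega)), ?_⟩
      cases hhi : J.hi with
      | top => exact WithTop.coe_lt_top _
      | coe r =>
        have h3 := (hT u J hJ).2 r hhi
        rw [hhi] at h2
        have := WithTop.coe_lt_coe.1 h2
        omega
  · push Not at h
    refine ⟨⊤, ⟨⟨le_top, fun b hb => by simp at hb⟩, fun z hz => ?_⟩, Or.inl rfl⟩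
    cases z with
    | top => exact le_rfl
    | coe z => exact absurd (h z (WithTop.coe_le_coe.1 hz.1)) (hz.2 z rfl)

theorem total_next (u : Pattern) : Procedure.Total B S {u} (next u) := by
  intro T x hT hx
  obtain ⟨y, hy, hy'⟩ := CDS.exists_isNext hT u hx
  refine ⟨T, y, 1, ⟨rfl, hy, rfl⟩, hT, hy', hy.1.1, fun p v h => Or.inl h, ?_, fun t h => h⟩
  rintro p rfl v hv
  exact hy.1.2 v hv

/-- A round that does not finish strictly increases the current value, and only finitely many finite
values are in range. -/
theorem total_repeatUntil {up here : Procedure} (h1 : Procedure.Total B S N up)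
    (h2 : Procedure.Total B S N' here) :
    Procedure.Total B S (N ∪ N') (RepeatUntil up here) := by
  -- The counter `d` bounds `B + 2 - x` for finite `x`. At `d = 0` only `x = ⊤` is left, and then
  -- both searches return `⊤`.
  have key : ∀ (d : ℕ) T x, CDS.Bounded B T → InRange B x →
      (∀ b : ℤ, x = b → B + 2 - b ≤ d) → ∃ T' y k, RepeatUntil up here T x T' y k ∧
      CDS.Bounded B T' ∧ InRange B y ∧ x ≤ y ∧
      (∀ p (v : ℤ), CDS.Covers T' p v → CDS.Covers T p v ∨ (p ∈ S ∧ (v : WithTop ℤ) < y)) ∧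
      (∀ p ∈ N ∪ N', ∀ v : ℤ, y = v → ¬ CDS.Covers T' p v) ∧
      ∀ t, CDS.Rules T t → CDS.Rules T' t := by
    intro d
    induction d with
    | zero =>
      intro T x hT hx hd
      have hx' : x = ⊤ := by
        rcases hx with rfl | ⟨b, rfl, _, hb⟩
        · rfl
        · have := hd b rfl
          omega
      subst hx'
      obtain ⟨T₁, z, k₁, a1, a2, a3, a4, a5, a6, a7⟩ := h1 T ⊤ hT hx
      obtain rfl := top_le_iff.1 a4
      obtain ⟨T₂, y, k₂, b1, b2, b3, b4, b5, b6, b7⟩ := h2 T₁ ⊤ a2 hx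
      obtain rfl := top_le_iff.1 b4
      refine ⟨T₂, ⊤, _, .done a1 b1, b2, b3, le_rfl, fun p v hv => ?_,
        fun p _ v hv => by simp at hv, fun t ht => b7 t (a7 t ht)⟩
      rcases b5 p v hv with hv | hv
      · exact a5 p v hv
      · exact Or.inr hv
    | succ d ih =>
      intro T x hT hx hd
      obtain ⟨T₁, z, k₁, a1, a2, a3, a4, a5, a6, a7⟩ := h1 T x hT hx
      obtain ⟨T₂, y, k₂, b1, b2, b3, b4, b5, b6, b7⟩ := h2 T₁ z a2 a3
      have hT₂ : ∀ p (v : ℤ), CDS.Covers T₂ p v →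
          CDS.Covers T p v ∨ (p ∈ S ∧ (v : WithTop ℤ) < y) := by
        intro p v hv
        rcases b5 p v hv with hv | hv
        · rcases a5 p v hv with hv | hv
          · exact Or.inl hv
          · exact Or.inr ⟨hv.1, hv.2.trans_le b4⟩
        · exact Or.inr hv
      by_cases hyz : y = z
      · subst hyz
        refine ⟨T₂, y, _, .done a1 b1, b2, b3, a4, hT₂, ?_, fun t ht => b7 t (a7 t ht)⟩
        -- The search `here` adds only intervals below the common answer, so the answer stays free
        -- at the nodes checked by `up`.
        rintro p (hp | hp) v rfl hv
        · rcases b5 p v hv with hv | hv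
          · exact a6 p hp v rfl hv
          · exact lt_irrefl _ hv.2
        · exact b6 p hp v rfl hv
      · have hlt : x < y := a4.trans_lt (lt_of_le_of_ne b4 (Ne.symm hyz))
        obtain ⟨T₃, r, k₃, c1, c2, c3, c4, c5, c6, c7⟩ := ih T₂ y b2 b3 (by
          rintro b rfl
          cases x with
          | top => simp at hlt
          | coe x =>
            have := hd x rfl
            have := WithTop.coe_lt_coe.1 hlt
            push_cast at *
            omega)
        refine ⟨T₃, r, _, .again a1 b1 hyz c1, c2, c3, hlt.le.trans c4, fun p v hv => ?_, c6,
          fun t ht => c7 t (b7 t (a7 t ht))⟩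
        rcases c5 p v hv with hv | hv
        · rcases hT₂ p v hv with hv | hv
          · exact Or.inl hv
          · exact Or.inr ⟨hv.1, hv.2.trans_le c4⟩
        · exact Or.inr hv
  intro T x hT hx
  refine key (B + 3).toNat T x hT hx fun b hb => ?_
  rcases hx with rfl | ⟨b', rfl, hb', _⟩
  · simp at hb
  · have := WithTop.coe_inj.1 hb
    omega

/-- The inserted interval ends before `y`, so `y` stays free. -/
theorem total_insertGap {P P' : Procedure} {u : Pattern} (hu : Below B u) (huS : u ∈ S)
    (h : Procedure.Total B S N P)
    (hP : ∀ T x T₁ y k, P T x T₁ y k → ∃ k', P' T x (T₁.insertGap u x y) y k') :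
    Procedure.Total B S N P' := by
  intro T x hT hx
  obtain ⟨T₁, y, k, a1, a2, a3, a4, a5, a6, a7⟩ := h T x hT hx
  obtain ⟨k', hk'⟩ := hP _ _ _ _ _ a1
  refine ⟨_, y, k', hk', CDS.bounded_insertGap a2 hu a3, a3, a4, fun p v hv => ?_, ?_,
    fun t ht => (a7 t ht).insertGap _ _ _⟩
  · rcases CDS.covers_insertGap hv with hv | ⟨rfl, _, hv⟩
    · exact a5 p v hv
    · exact Or.inr ⟨huS, hv⟩
  · rintro p hp v rfl hv
    rcases CDS.covers_insertGap hv with hv | ⟨_, _, hv⟩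
    · exact a6 p hp v rfl hv
    · exact lt_irrefl _ hv

theorem Procedure.Total.mono {P : Procedure} (h : Procedure.Total B S N P) (hN : N' ⊆ N) :
    Procedure.Total B S N' P := by
  intro T x hT hx
  obtain ⟨T₁, y, k, a1, a2, a3, a4, a5, a6, a7⟩ := h T x hT hx
  exact ⟨T₁, y, k, a1, a2, a3, a4, a5, fun p hp => a6 p (hN hp), a7⟩

theorem total_nextPairVal {s u : Pattern} (hs : Below B s) (hS : s ∈ S) :
    Procedure.Total B S {s, u} (nextPairVal s u) := by
  unfold nextPairVal
  split_ifs with h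
  · subst h
    exact (total_next s).mono (by simp)
  · refine total_insertGap (P := RepeatUntil (nextChainVal [u]) (next s)) hs hS ?_ ?_
    · refine (total_repeatUntil (total_next u) (total_next s)).mono ?_
      rintro p (rfl | rfl)
      · exact Or.inr rfl
      · exact Or.inl rfl
    · intro T x T₁ y k hk
      exact ⟨k + 1, T₁, k, hk, rfl, rfl⟩

theorem total_nextShadowChainVal : ∀ {s : Pattern × Pattern} {L : List (Pattern × Pattern)},
    (∀ r ∈ s :: L, Below B r.1) → (∀ r ∈ s :: L, r.1 ∈ S) →
    Procedure.Total B S {p | ∃ r ∈ s :: L, p = r.1 ∨ p = r.2} (nextShadowChainVal (s :: L))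
  | s, [], hB, hS =>
    (total_nextPairVal (hB s (by simp)) (hS s (by simp))).mono (by
      rintro p ⟨r, hr, h⟩
      rw [List.mem_singleton.1 hr] at h
      exact h)
  | s, s' :: L, hB, hS => by
    have ih := total_nextShadowChainVal (s := s') (L := L)
      (fun r hr => hB r (List.mem_cons_of_mem _ hr)) (fun r hr => hS r (List.mem_cons_of_mem _ hr))
    refine total_insertGap
      (P := RepeatUntil (nextShadowChainVal (s' :: L)) (nextPairVal s.1 s.2))
      (hB s (by simp)) (hS s (by simp)) ?_ ?_
    · refine (total_repeatUntil ih
        (total_nextPairVal (u := s.2) (hB s (by simp)) (hS s (by simp)))).mono ?_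
      rintro p ⟨r, hr, h⟩
      rcases List.mem_cons.1 hr with rfl | hr
      · exact Or.inr h
      · exact Or.inl ⟨r, hr, h⟩
    · intro T x T₁ y k hk
      exact ⟨k + 1, T₁, k, hk, rfl, rfl⟩

end Total

/-- The prefixes in the box `[-1, B + 1] ^ n` that `T` does not rule out. -/
def unruled (n : ℕ) (B : ℤ) (T : CDS) : Set (List ℤ) :=
  {t | (t.length ≤ n ∧ ∀ x ∈ t, -1 ≤ x ∧ x ≤ B + 1) ∧ ¬ T.Rules t}

theorem finite_unruled (n : ℕ) (B : ℤ) (T : CDS) : (unruled n B T).Finite := by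
  have h : {t : List ℤ | t.length ≤ n ∧ ∀ x ∈ t, -1 ≤ x ∧ x ≤ B + 1}.Finite := by
    have : Finite (Set.Icc (-1 : ℤ) (B + 1)) := (Set.finite_Icc _ _).to_subtype
    refine ((List.finite_length_le (Set.Icc (-1 : ℤ) (B + 1)) n).image
      (List.map Subtype.val)).subset ?_
    rintro t ⟨h1, h2⟩
    lift t to List (Set.Icc (-1 : ℤ) (B + 1)) using h2
    exact ⟨t, by simpa using h1, rfl⟩
  exact h.subset fun t ht => ht.1

theorem ncard_unruled_lt {n : ℕ} {B : ℤ} {T T' : CDS} (h : ∀ t, T.Rules t → T'.Rules t)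
    {t : List ℤ} (ht : t ∈ unruled n B T) (ht' : T'.Rules t) :
    (unruled n B T').ncard < (unruled n B T).ncard := by
  refine Set.ncard_lt_ncard ?_ (finite_unruled n B T)
  refine (Set.ssubset_iff_of_subset ?_).2 ?_
  · exact fun s hs => ⟨hs.1, fun h' => hs.2 (h s h')⟩
  exact ⟨t, ht, fun h' => h'.2 ht'⟩

theorem ncard_unruled_le {n : ℕ} {B : ℤ} {T T' : CDS} (h : ∀ t, T.Rules t → T'.Rules t) :
    (unruled n B T').ncard ≤ (unruled n B T).ncard :=
  Set.ncard_le_ncard (fun s hs => ⟨hs.1, fun h' => hs.2 (h s h')⟩) (finite_unruled n B T)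

theorem CDS.Rules.of_take {T : CDS} {t : List ℤ} {i : ℕ} (h : T.Rules (t.take i)) :
    T.Rules t := by
  obtain ⟨p, J, hJ, y, h1, h2, h3⟩ := h
  have hi : p.length < i := by
    by_contra hi
    rw [List.getElem?_take, if_neg hi] at h2
    simp at h2
  refine ⟨p, J, hJ, y, ?_, ?_, h3⟩
  · rwa [List.take_take, min_eq_left hi.le] at h1
  · rwa [List.getElem?_take, if_pos hi] at h2

/-- These are the two cases after a failed search: no probe point, or backtracking to the last
equality component. -/
theorem exists_eq_append_replicate (p : Pattern) :
    p = List.replicate p.length none ∨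
      ∃ q c j, p = q ++ some c :: List.replicate j none := by
  induction p using List.reverseRecOn with
  | nil => exact Or.inl rfl
  | append_singleton p a ih =>
    cases a with
    | some a => exact Or.inr ⟨p, a, 0, by simp⟩
    | none =>
      rcases ih with ih | ⟨q, c, j, rfl⟩
      · left
        rw [List.length_append, List.length_singleton, List.replicate_succ', ← ih]
      · right
        exact ⟨q, c, j + 1, by simp [List.replicate_succ']⟩

/-- `getProbePoint` can return from every unruled prefix. -/
theorem GetProbePoint.exists {n : ℕ} {B : ℤ} (hB : 0 ≤ B) (N d : ℕ) : ∀ (T : CDS) (t : List ℤ),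
    T.Bounded B → t ∈ unruled n B T → (unruled n B T).ncard ≤ N → n - t.length ≤ d →
    ∃ T' r k, GetProbePoint n T t T' r k ∧ T'.Bounded B ∧ (∀ s, T.Rules s → T'.Rules s) ∧
      ∀ s, r = some s → s.length = n ∧ s ∈ unruled n B T' := by
  -- The outer induction is on the number of unruled prefixes, which backtracking decreases; the
  -- inner one is on the number of missing coordinates.
  induction N generalizing d with
  | zero =>
    intro T t _ ht hN _
    have : 0 < (unruled n B T).ncard := (Set.ncard_pos (finite_unruled n B T)).2 ⟨t, ht⟩
    omega
  | succ N ihN =>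
    induction d with
    | zero =>
      intro T t hT ht _ hd
      have hl : t.length = n := le_antisymm ht.1.1 (by omega)
      exact ⟨T, some t, 0, .found hl, hT, fun s hs => hs, by rintro s ⟨⟩; exact ⟨hl, ht⟩⟩
    | succ d ihd =>
      intro T t hT ht hN hd
      rcases ht.1.1.eq_or_lt with hl | hl
      · exact ⟨T, some t, 0, .found hl, hT, fun s hs => hs, by rintro s ⟨⟩; exact ⟨hl, ht⟩⟩
      have happ : ∀ (T₁ : CDS) (y : ℤ), -1 ≤ y → y ≤ B + 1 → ¬ T₁.Rules (t ++ [y]) →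
          t ++ [y] ∈ unruled n B T₁ := by
        intro T₁ y h1 h2 h3
        refine ⟨⟨by simp; omega, fun x hx => ?_⟩, h3⟩
        rcases List.mem_append.1 hx with hx | hx
        · exact ht.1.2 x hx
        · rw [List.mem_singleton.1 hx]; exact ⟨h1, h2⟩
      -- A constraint that rules out `t ++ [y]` but not `t` must have its interval on the last
      -- coordinate.
      have hrules : ∀ (T₁ : CDS) (y : ℤ), ¬ T₁.Rules t →
          (∀ p, Specializes (t.map some) p → ¬ T₁.Covers p y) → ¬ T₁.Rules (t ++ [y]) := by
        intro T₁ y h1 h2 h3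
        obtain ⟨p, z, a1, a2, a3⟩ := CDS.rules_iff.1 h3
        rcases Nat.lt_or_ge p.length t.length with hp | hp
        · refine h1 (CDS.rules_iff.2 ⟨p, z, ?_, ?_, a3⟩)
          · rwa [List.take_append_of_le_length hp.le] at a1
          · rwa [List.getElem?_append_left hp] at a2
        · have hp' : p.length = t.length := by
            have := (List.getElem?_eq_some_iff.1 a2).1
            simp at this
            omega
          rw [hp'] at a1 a2
          simp at a1 a2
          subst a2
          exact h2 p a1 a3
      obtain ⟨lin, hlin⟩ := exists_linearization T t
      cases hlin' : shadows lin with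
      | nil =>
        have : lin = [] := by
          cases lin with
          | nil => rfl
          | cons u us => simp [shadows] at hlin'
        subst this
        have h1 : ¬ T.Rules (t ++ [-1]) := by
          refine hrules T (-1) ht.2 fun p hp hc => ?_
          obtain ⟨J, hJ, _⟩ := hc
          have := (hlin.2.1 p).2 ⟨hp, List.ne_nil_of_mem hJ⟩
          simp at this
        obtain ⟨T', r, k, a1, a2, a3, a4⟩ := ihd T (t ++ [-1]) hT
          (happ T (-1) le_rfl (by omega) h1) hN (by simp; omega)
        exact ⟨T', r, k + 1, .free hl hlin a1, a2, a3, a4⟩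
      | cons s L =>
        have hgen : ∀ p ∈ lin, Specializes (t.map some) p := fun p hp => ((hlin.2.1 p).1 hp).1
        have hL : IsShadowChain lin (s :: L) := by
          refine ⟨by rw [hlin'], ?_⟩
          have := (shadows_spec hgen).1.1
          rwa [hlin'] at this
        have hsh := (shadows_spec hgen).2
        have hbel : ∀ r ∈ shadows lin, Below B r.1 := below_shadows fun p hp => by
          obtain ⟨J, hJ⟩ := List.exists_mem_of_ne_nil _ ((hlin.2.1 p).1 hp).2
          exact (hT p J hJ).1
        rw [hlin'] at hbel hsh
        obtain ⟨T₁, y, k₁, a1, a2, a3, a4, a5, a6, a7⟩ :=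
          total_nextShadowChainVal (S := {p | ∃ r ∈ s :: L, r.1 = p}) hbel
          (fun r hr => ⟨r, hr, rfl⟩)
          (addShadows T (shadows lin)) ((-1 : ℤ) : WithTop ℤ)
          (CDS.bounded_addShadows hB (by rwa [hlin']) hT)
          (Or.inr ⟨-1, rfl, le_rfl, by omega⟩)
        have hmono : ∀ s, T.Rules s → T₁.Rules s := fun s hs => a7 s hs.addShadows
        have hcov : ∀ p v, T₁.Covers p v → T.Covers p v ∨ ∃ r ∈ s :: L, r.1 = p := by
          intro p v hv
          rcases a5 p v hv with hv | hv
          · rcases CDS.covers_addShadows hv with hv | ⟨_, hv⟩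
            · exact Or.inl hv
            · rw [hlin'] at hv; exact Or.inr hv
          · exact Or.inr hv.1
        -- All new intervals are at shadow nodes, whose patterns have the length of `t`. They
        -- constrain the next attribute only.
        have ht₁ : ¬ T₁.Rules t := by
          intro h
          obtain ⟨p, z, b1, b2, b3⟩ := CDS.rules_iff.1 h
          rcases hcov p z b3 with hc | ⟨r, hr, rfl⟩
          · exact ht.2 (CDS.rules_iff.2 ⟨p, z, b1, b2, hc⟩)
          · have h1 := (hsh r hr).length_eq
            have h2 := (List.getElem?_eq_some_iff.1 b2).1
            simp at h1
            omega
        rcases a3 with rfl | ⟨b, rfl, hb1, hb2⟩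
        · rcases exists_eq_append_replicate s.1 with hs | ⟨q, c, j, hs⟩
          · have h1 := (hsh s (by simp)).length_eq
            rw [List.length_map] at h1
            rw [← h1] at hs
            exact ⟨T₁, none, _, .null hl hlin hL a1 hs, a2, hmono, by simp⟩
          · have hts := hsh s (by simp)
            have hbs := hbel s (by simp)
            rw [hs] at hts hbs
            set T₂ := T₁.insert q ⟨((c - 1 : ℤ) : WithBot ℤ), ((c + 1 : ℤ) : WithTop ℤ)⟩ with hT₂
            have hmono' : ∀ s, T.Rules s → T₂.Rules s := fun s hs => (hmono s hs).insert _ _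
            have hq : Specializes ((t.take q.length).map some) q := by
              have := hts.take q.length
              rwa [List.take_left, ← List.map_take] at this
            have hc : t[q.length]? = some c := by
              have := hts.getElem? (i := q.length) (c := c) (by simp)
              rw [List.getElem?_map] at this
              simpa using this
            have hql : q.length < t.length := (List.getElem?_eq_some_iff.1 hc).1
            have hT₂b : T₂.Bounded B := by
              refine a2.insert (fun a ha => hbs a (by simp [ha])) fun r hr => ?_
              have h1 := WithTop.coe_inj.1 hr
              have h2 := hbs c (by simp)
              omega
            have hsub : ∀ i, ∀ x ∈ t.take i, x ∈ t := fun i x hx => List.mem_of_mem_take hx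
            -- The bottom shadow generalizes `t`, so the coordinate of `t` at its last equality
            -- component is `c`, and the new constraint rules out `t`.
            have hlt : (unruled n B T₂).ncard < (unruled n B T).ncard := by
              refine ncard_unruled_lt hmono' ht (CDS.rules_insert ⟨c, hq, hc, ?_⟩)
              exact ⟨WithBot.coe_lt_coe.2 (by omega), WithTop.coe_lt_coe.2 (by omega)⟩
            have ht₂ : t.take q.length ∈ unruled n B T₂ := by
              refine ⟨⟨by simp; omega, fun x hx => ht.1.2 x (hsub _ x hx)⟩, fun h => ?_⟩
              obtain ⟨p, z, b1, b2, b3⟩ := CDS.rules_iff.1 h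
              rcases CDS.covers_of_covers_insert b3 with b3 | ⟨rfl, _⟩
              · exact ht₁ (CDS.Rules.of_take (CDS.rules_iff.2 ⟨p, z, b1, b2, b3⟩))
              · simp at b2
            obtain ⟨T', r, k, e1, e2, e3, e4⟩ := ihN n T₂ _ hT₂b ht₂ (by omega) (by omega)
            exact ⟨T', r, _, .backtrack hl hlin hL a1 hs e1, e2,
              fun s hs => e3 s (hmono' s hs), e4⟩
        · have h1 : ¬ T₁.Rules (t ++ [b]) := by
            refine hrules T₁ b ht₁ fun p hp hc => ?_
            rcases hcov p b hc with hc' | ⟨r, hr, rfl⟩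
            · obtain ⟨J, hJ, _⟩ := hc'
              obtain ⟨r, hr, hrp⟩ := mem_shadows_snd ((hlin.2.1 p).2 ⟨hp, List.ne_nil_of_mem hJ⟩)
              rw [hlin'] at hr
              exact a6 p ⟨r, hr, Or.inr hrp.symm⟩ b rfl hc
            · exact a6 _ ⟨r, hr, Or.inl rfl⟩ b rfl hc
          obtain ⟨T', r, k, e1, e2, e3, e4⟩ := ihd T₁ (t ++ [b]) a2
            (happ T₁ b hb1 hb2 h1) ((ncard_unruled_le hmono).trans hN) (by simp; omega)
          exact ⟨T', r, _, .advance hl hlin hL a1 e1, e2, fun s hs => e3 s (hmono s hs), e4⟩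

theorem foldl_insert {B : ℤ} {L : List (Pattern × Interval)}
    (hL : ∀ c ∈ L, Below B c.1 ∧ ∀ r : ℤ, c.2.hi = r → r ≤ B + 1) {T : CDS} (hT : T.Bounded B) :
    (L.foldl (fun T c => T.insert c.1 c.2) T).Bounded B ∧
      (∀ t, T.Rules t → (L.foldl (fun T c => T.insert c.1 c.2) T).Rules t) ∧
      ∀ t, ∀ c ∈ L, CDS.RulesOut c.1 c.2 t →
        (L.foldl (fun T c => T.insert c.1 c.2) T).Rules t := by
  induction L generalizing T with
  | nil => exact ⟨hT, fun t h => h, by simp⟩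
  | cons c L ih =>
    obtain ⟨h1, h2⟩ := hL c (by simp)
    obtain ⟨i1, i2, i3⟩ := ih (fun c hc => hL c (by simp [hc])) (hT.insert h1 h2)
    refine ⟨i1, fun t ht => i2 t (ht.insert _ _), fun t c' hc' ht => ?_⟩
    rcases List.mem_cons.1 hc' with rfl | hc'
    · exact i2 t (CDS.rules_insert ht)
    · exact i3 t c' hc' ht

/-- Minesweeper can halt on an instance with empty output if the gaps around every point rule
out the point. -/
theorem Run.exists {Q : JoinQuery} {I : Instance Q} (hI : I.output = ∅) {B : ℤ} (hB : 0 ≤ B)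
    (hgap : ∀ t, ∀ c ∈ gapConstraints I t, Below B c.1 ∧ ∀ r : ℤ, c.2.hi = r → r ≤ B + 1)
    (hrules : ∀ t : List ℤ, t.length = Q.n → ∃ c ∈ gapConstraints I t, CDS.RulesOut c.1 c.2 t) :
    ∃ out k, Run I out k := by
  have key : ∀ (N : ℕ) (T : CDS), T.Bounded B → (unruled Q.n B T).ncard ≤ N →
      ∃ out k, RunFrom I T out k := by
    intro N
    induction N with
    | zero =>
      intro T hT hN
      -- The empty prefix is never ruled out, so the count is positive and this case is void.
      have h0 : ¬ [] ∈ unruled Q.n B T := fun h => by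
        have : 0 < (unruled Q.n B T).ncard :=
          (Set.ncard_pos (finite_unruled Q.n B T)).2 ⟨[], h⟩
        omega
      refine absurd ⟨⟨by simp, by simp⟩, ?_⟩ h0
      rintro ⟨p, J, hJ, y, _, h, _⟩
      simp at h
    | succ N ih =>
      intro T hT hN
      have h0 : [] ∈ unruled Q.n B T := by
        refine ⟨⟨by simp, by simp⟩, ?_⟩
        rintro ⟨p, J, hJ, y, _, h, _⟩
        simp at h
      obtain ⟨T', r, k, h1, h2, h3, h4⟩ := GetProbePoint.exists hB _ _ T [] hT h0 hN le_rfl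
      cases r with
      | none => exact ⟨[], k, .halt h1⟩
      | some t =>
        obtain ⟨ht, ht'⟩ := h4 t rfl
        obtain ⟨i1, i2, i3⟩ := foldl_insert (hgap t) h2
        obtain ⟨c, hc, hct⟩ := hrules t ht
        have hlt := ncard_unruled_lt i2 ht' (i3 t c hc hct)
        have hle := ncard_unruled_le (n := Q.n) (B := B) h3
        obtain ⟨out, k', hk'⟩ := ih _ i1 (by omega)
        exact ⟨out, _, .explore h1 (by simp [hI]) hk'⟩
  refine key _ CDS.init ?_ le_rfl
  intro p J hJ
  unfold CDS.intervals CDS.init at hJ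
  split_ifs at hJ <;> simp at hJ

/-! ## Gaps -/

theorem mem_children {R : Finset (List ℕ)} {p : List ℕ} {c : ℕ} :
    c ∈ children R p ↔ ∃ r ∈ R, p ++ [c] <+: r := by
  simp only [children, Finset.mem_image, Finset.mem_filter]
  constructor
  · rintro ⟨r, ⟨hr, ⟨s, rfl⟩, hl⟩, rfl⟩
    refine ⟨_, hr, ?_⟩
    cases s with
    | nil => simp at hl
    | cons b s => exact ⟨s, by simp⟩
  · rintro ⟨r, hr, s, rfl⟩
    exact ⟨_, ⟨hr, ⟨c :: s, by simp⟩, by simp⟩, by simp⟩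

theorem mem_of_gapLo {R : Finset (List ℕ)} {p : List ℕ} {v : ℤ} {c : ℕ}
    (h : gapLo R p v = WithBot.some c) : c ∈ children R p :=
  (Finset.mem_filter.1 (Finset.mem_of_max h)).1

theorem mem_of_gapHi {R : Finset (List ℕ)} {p : List ℕ} {v : ℤ} {c : ℕ}
    (h : gapHi R p v = WithTop.some c) : c ∈ children R p :=
  (Finset.mem_filter.1 (Finset.mem_of_min h)).1

/-- The ends of the gap are the children nearest to `v` on either side, so no child lies strictly
between them. -/
theorem notMem_of_mem_gapInterval {R : Finset (List ℕ)} {p : List ℕ} {v : ℤ} {c : ℕ}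
    (h : (gapInterval R p v).Mem c) : c ∉ children R p := by
  intro hc
  rcases le_total (c : ℤ) v with hv | hv
  · have h1 := Finset.le_max (s := (children R p).filter fun c : ℕ => (c : ℤ) ≤ v)
      (Finset.mem_filter.2 ⟨hc, hv⟩)
    have h2 := h.1
    simp only [gapInterval, gapLo] at h2
    cases hd : (Finset.filter (fun c : ℕ => (c : ℤ) ≤ v) (children R p)).max with
    | bot => rw [hd] at h1; simp at h1
    | coe d =>
      rw [hd] at h1 h2
      have h3 := WithBot.coe_le_coe.1 h1
      have h4 := WithBot.coe_lt_coe.1 h2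
      dsimp only at h4
      omega
  · have h1 := Finset.min_le (s := (children R p).filter fun c : ℕ => v ≤ (c : ℤ))
      (Finset.mem_filter.2 ⟨hc, hv⟩)
    have h2 := h.2
    simp only [gapInterval, gapHi] at h2
    cases hd : (Finset.filter (fun c : ℕ => v ≤ (c : ℤ)) (children R p)).min with
    | top => rw [hd] at h1; simp at h1
    | coe d =>
      rw [hd] at h1 h2
      have h3 := WithTop.coe_le_coe.1 h1
      have h4 := WithTop.coe_lt_coe.1 h2
      dsimp only at h4
      omega

theorem mem_gapInterval {R : Finset (List ℕ)} {p : List ℕ} {v : ℤ}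
    (h : ∀ c ∈ children R p, (c : ℤ) ≠ v) : (gapInterval R p v).Mem v := by
  constructor
  · simp only [gapInterval]
    cases hd : gapLo R p v with
    | bot => exact WithBot.bot_lt_coe _
    | coe d =>
      have h1 := Finset.mem_filter.1 (Finset.mem_of_max hd)
      exact WithBot.coe_lt_coe.2 (lt_of_le_of_ne h1.2 (h d h1.1))
  · simp only [gapInterval]
    cases hd : gapHi R p v with
    | top => exact WithTop.coe_lt_top _
    | coe d =>
      have h1 := Finset.mem_filter.1 (Finset.mem_of_min hd)
      exact WithTop.coe_lt_coe.2 (lt_of_le_of_ne h1.2 (h d h1.1).symm)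

theorem gapLo_of_mem {R : Finset (List ℕ)} {p : List ℕ} {c : ℕ} (h : c ∈ children R p) :
    gapLo R p c = WithBot.some c := by
  have h1 := Finset.le_max (s := (children R p).filter fun d : ℕ => (d : ℤ) ≤ c)
    (Finset.mem_filter.2 ⟨h, le_rfl⟩)
  unfold gapLo
  cases hd : (Finset.filter (fun d : ℕ => (d : ℤ) ≤ c) (children R p)).max with
  | bot => rw [hd] at h1; simp at h1
  | coe d =>
    rw [hd] at h1
    have h2 := WithBot.coe_le_coe.1 h1
    have h3 := (Finset.mem_filter.1 (Finset.mem_of_max hd)).2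
    rw [le_antisymm (by exact_mod_cast h3) h2]

theorem hi_gapInterval {R : Finset (List ℕ)} {p : List ℕ} {v r : ℤ}
    (h : (gapInterval R p v).hi = r) : ∃ c ∈ children R p, (c : ℤ) = r := by
  simp only [gapInterval] at h
  cases hd : gapHi R p v with
  | top => rw [hd] at h; simp at h
  | coe d =>
    rw [hd] at h
    exact ⟨d, mem_of_gapHi hd, WithTop.coe_inj.1 h⟩

theorem getElem?_gapPattern {s p : List ℕ} {len i : ℕ} (hi : i < len) :
    (gapPattern s p len)[i]? = some (((s.zip p).lookup i).map (fun c : ℕ => (c : ℤ))) := by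
  simp [gapPattern, hi]

theorem length_gapPattern (s p : List ℕ) (len : ℕ) : (gapPattern s p len).length = len := by
  simp [gapPattern]

theorem mem_of_lookup {s p : List ℕ} {i c : ℕ} (h : (s.zip p).lookup i = some c) : c ∈ p := by
  rw [List.lookup_eq_some_iff] at h
  obtain ⟨l₁, l₂, h, _⟩ := h
  exact (List.of_mem_zip (a := i) (b := c) (by rw [h]; simp)).2

theorem specializes_gapPattern {s p : List ℕ} {len : ℕ} {t : List ℤ} (hlen : len ≤ t.length)
    (h : ∀ i < len, ∀ c : ℕ, (s.zip p).lookup i = some c → t[i]? = some (c : ℤ)) :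
    Specializes ((t.take (gapPattern s p len).length).map some) (gapPattern s p len) := by
  rw [length_gapPattern]
  refine List.forall₂_of_length_eq_of_get (by simp [length_gapPattern, hlen]) ?_
  intro i h1 h2
  rw [length_gapPattern] at h2
  have h3 := getElem?_gapPattern (s := s) (p := p) h2
  rw [List.getElem?_eq_getElem (by rwa [length_gapPattern])] at h3
  have h3 := Option.some.inj h3
  simp only [List.get_eq_getElem, List.getElem_map, List.getElem_take]
  rw [h3]
  cases hc : (s.zip p).lookup i with
  | none => exact Or.inl rfl
  | some c =>
    right
    have := h i h2 c hc
    rw [List.getElem?_eq_getElem (by omega)] at this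
    rw [Option.some.inj this]
    rfl

theorem mem_gapConstraints {Q : JoinQuery} {I : Instance Q} {t : List ℤ}
    {c : Pattern × Interval} : c ∈ gapConstraints I t ↔
      ∃ a, ∃ j, ∃ h : j < (Q.pos a).length, ∃ p ∈ exploredNodes (I.rel a)
        (fun j => t.getD (((Q.pos a).map Fin.val).getD j 0) 0) j,
        c = (gapPattern ((Q.pos a).map Fin.val) p ((Q.pos a)[j] : Fin Q.n),
          gapInterval (I.rel a) p (t.getD ((Q.pos a)[j] : Fin Q.n) 0)) := by
  -- In `gapConstraints` the passage from attributes to numbers is a monadic lift of the whole list;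
  -- it equals `l.map Fin.val`.
  have hs : ∀ l : List (Fin Q.n), (List.map (fun i => i) do let i ← l; pure (i : ℕ)) =
      l.map Fin.val := by
    intro l
    rw [List.map_id', List.map_eq_flatMap]
    rfl
  simp only [gapConstraints, hs, List.mem_flatMap, List.mem_finRange, true_and, List.mem_range,
    List.mem_map, List.length_map]
  constructor
  · rintro ⟨a, j, hj, p, hp, rfl⟩
    refine ⟨a, j, hj, p, hp, ?_⟩
    simp [hj]
  · rintro ⟨a, j, hj, p, hp, rfl⟩
    refine ⟨a, j, hj, p, hp, ?_⟩
    simp [hj]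

/-! ## Product relations -/

/-- The product of a list of finite sets. -/
def prodRel : List (Finset ℕ) → Finset (List ℕ)
  | [] => {[]}
  | D :: Ds => (D ×ˢ prodRel Ds).image fun x => x.1 :: x.2

theorem mem_prodRel {Ds : List (Finset ℕ)} {r : List ℕ} :
    r ∈ prodRel Ds ↔ List.Forall₂ (· ∈ ·) r Ds := by
  induction Ds generalizing r with
  | nil => simp [prodRel]
  | cons D Ds ih =>
    simp only [prodRel, Finset.mem_image, Finset.mem_product, Prod.exists,
      List.forall₂_cons_right_iff, ih]
    constructor
    · rintro ⟨a, b, ⟨h1, h2⟩, rfl⟩; exact ⟨a, b, h1, h2, rfl⟩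
    · rintro ⟨a, b, h1, h2, rfl⟩; exact ⟨a, b, ⟨h1, h2⟩, rfl⟩

theorem card_prodRel (Ds : List (Finset ℕ)) :
    (prodRel Ds).card = (Ds.map Finset.card).prod := by
  induction Ds with
  | nil => simp [prodRel]
  | cons D Ds ih =>
    rw [prodRel, Finset.card_image_of_injective, Finset.card_product, ih]
    · simp
    · rintro ⟨a, b⟩ ⟨c, d⟩ h
      simpa using h

/-- As no factor is empty, every partial tuple extends. Hence all nodes of one depth have the same
children, which makes the gaps computable. -/
theorem exists_mem_prodRel {Ds : List (Finset ℕ)} (hne : ∀ D ∈ Ds, D.Nonempty) {p : List ℕ}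
    (hp : List.Forall₂ (· ∈ ·) p (Ds.take p.length)) : ∃ r ∈ prodRel Ds, p <+: r := by
  induction Ds generalizing p with
  | nil =>
    simp at hp
    exact ⟨[], by simp [prodRel], by simp [hp]⟩
  | cons D Ds ih =>
    cases p with
    | nil =>
      obtain ⟨r, hr, _⟩ := ih (fun E hE => hne E (by simp [hE])) (p := []) (by simp)
      obtain ⟨c, hc⟩ := hne D (by simp)
      exact ⟨c :: r, mem_prodRel.2 (.cons hc (mem_prodRel.1 hr)), by simp⟩
    | cons c p =>
      simp only [List.length_cons, List.take_succ_cons, List.forall₂_cons] at hp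
      obtain ⟨r, hr, hpr⟩ := ih (fun E hE => hne E (by simp [hE])) hp.2
      exact ⟨c :: r, mem_prodRel.2 (.cons hp.1 (mem_prodRel.1 hr)),
        List.cons_prefix_cons.2 ⟨rfl, hpr⟩⟩

theorem forall₂_snoc {p : List ℕ} {Ds : List (Finset ℕ)} {c : ℕ}
    (hp : List.Forall₂ (· ∈ ·) p (Ds.take p.length)) (hj : p.length < Ds.length) :
    List.Forall₂ (· ∈ ·) (p ++ [c]) (Ds.take (p ++ [c]).length) ↔ c ∈ Ds[p.length] := by
  rw [List.length_append, List.length_singleton, List.take_succ_eq_append_getElem hj]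
  constructor
  · intro h
    have := List.forall₂_drop p.length h
    rw [List.drop_left, List.drop_append_of_le_length (by simp; omega)] at this
    rw [List.drop_eq_nil_of_le (by simp)] at this
    simpa using this
  · intro h
    exact List.rel_append hp (.cons h .nil)

theorem children_prodRel {Ds : List (Finset ℕ)} (hne : ∀ D ∈ Ds, D.Nonempty) {p : List ℕ}
    (hp : List.Forall₂ (· ∈ ·) p (Ds.take p.length)) (hj : p.length < Ds.length) :
    children (prodRel Ds) p = Ds[p.length] := by
  ext c
  rw [mem_children, ← forall₂_snoc hp hj]
  constructor
  · rintro ⟨r, hr, hpr⟩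
    have := List.forall₂_take (p ++ [c]).length (mem_prodRel.1 hr)
    rwa [← List.prefix_iff_eq_take.1 hpr] at this
  · exact exists_mem_prodRel hne

theorem mem_exploredNodes_prodRel {Ds : List (Finset ℕ)} (hne : ∀ D ∈ Ds, D.Nonempty)
    {v : ℕ → ℤ} {j : ℕ} (hj : j ≤ Ds.length) {p : List ℕ}
    (hp : p ∈ exploredNodes (prodRel Ds) v j) :
    p.length = j ∧ List.Forall₂ (· ∈ ·) p (Ds.take p.length) := by
  induction j generalizing p with
  | zero =>
    simp only [exploredNodes, List.mem_singleton] at hp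
    subst hp
    simp
  | succ j ih =>
    simp only [exploredNodes, List.mem_flatMap] at hp
    obtain ⟨q, hq, hp⟩ := hp
    obtain ⟨h1, h2⟩ := ih (by omega) hq
    obtain ⟨c, hc, rfl⟩ : ∃ c ∈ children (prodRel Ds) q, p = q ++ [c] := by
      rcases List.mem_append.1 hp with hp | hp
      · cases hd : gapLo (prodRel Ds) q (v j) with
        | bot => rw [hd] at hp; simp at hp
        | coe d =>
          rw [hd] at hp
          exact ⟨d, mem_of_gapLo hd, List.mem_singleton.1 hp⟩
      · cases hd : gapHi (prodRel Ds) q (v j) with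
        | top => rw [hd] at hp; simp at hp
        | coe d =>
          rw [hd] at hp
          exact ⟨d, mem_of_gapHi hd, List.mem_singleton.1 hp⟩
    refine ⟨by simp [h1], ?_⟩
    rw [children_prodRel hne h2 (by omega)] at hc
    exact (forall₂_snoc h2 (by omega)).2 hc

/-! ## The grid instances -/

section Grid

variable (Q : JoinQuery) (w m : ℕ)

open Classical in
/-- The values of the attribute `v` in the relation of the atom `a`. On the attribute `w`, the
atom with the attributes `i` and `w` misses the value `i`. -/
noncomputable def dom (a : Fin Q.m) (v : Fin Q.n) : Finset ℕ :=
  if (v : ℕ) = w then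
    (Finset.range w).filter fun c => ¬ ∃ i : Fin Q.n, (i : ℕ) = c ∧ Q.attrs a = {i, v}
  else Finset.range m

/-- All relations are products, with the values `0, …, m - 1` on the first `w` attributes. -/
noncomputable def gridInstance : Instance Q where
  rel a := prodRel ((Q.pos a).map (dom Q w m a))
  rel_length a r hr := by
    rw [(mem_prodRel.1 hr).length_eq, List.length_map, JoinQuery.pos, Finset.length_sort]

variable {Q w m}

theorem mem_dom_of_eq {a : Fin Q.m} {v : Fin Q.n} (hv : (v : ℕ) = w) {c : ℕ} :
    c ∈ dom Q w m a v ↔ c < w ∧ ∀ i : Fin Q.n, (i : ℕ) = c → Q.attrs a ≠ {i, v} := by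
  simp [dom, hv]

theorem dom_of_ne {a : Fin Q.m} {v : Fin Q.n} (hv : (v : ℕ) ≠ w) :
    dom Q w m a v = Finset.range m := by
  simp [dom, hv]

/-- The set `{i, v}` determines `i`, so `i` is the only value missing. -/
theorem dom_pair {a : Fin Q.m} {i v : Fin Q.n} (hv : (v : ℕ) = w) (hi : (i : ℕ) < w)
    (ha : Q.attrs a = {i, v}) : dom Q w m a v = (Finset.range w).erase i := by
  ext c
  rw [mem_dom_of_eq hv, Finset.mem_erase, Finset.mem_range, and_comm]
  refine and_congr_left fun hc => ⟨fun h hci => h i hci.symm ha, fun h j hj hj' => h ?_⟩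
  have : i ∈ Q.attrs a := by simp [ha]
  rw [hj', Finset.mem_insert, Finset.mem_singleton] at this
  rcases this with rfl | rfl
  · exact hj.symm
  · omega

/-- An atom has the form `{i, v}` for at most one `i < w`, so it cannot miss both `0` and `1`. This
is where `w ≥ 2` enters. -/
theorem nonempty_dom (hm : 0 < m) (hw : 2 ≤ w) (a : Fin Q.m) (v : Fin Q.n) :
    (dom Q w m a v).Nonempty := by
  by_cases hv : (v : ℕ) = w
  · by_contra hne
    have h0 : 0 ∉ dom Q w m a v := fun h => hne ⟨_, h⟩
    have h1 : 1 ∉ dom Q w m a v := fun h => hne ⟨_, h⟩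
    rw [mem_dom_of_eq hv] at h0 h1
    push Not at h0 h1
    obtain ⟨i, hi, hi'⟩ := h0 (by omega)
    obtain ⟨j, hj, hj'⟩ := h1 (by omega)
    have : i ∈ Q.attrs a := by simp [hi']
    rw [hj', Finset.mem_insert, Finset.mem_singleton] at this
    rcases this with rfl | rfl <;> omega
  · rw [dom_of_ne hv]; exact ⟨0, by simpa using hm⟩

end Grid

/-! ### Gaps and executions on the grid instances -/

section Grid

variable {Q : JoinQuery} {w m : ℕ}

theorem nonempty_of_mem_map_dom (hm : 0 < m) (hw : 2 ≤ w) (a : Fin Q.m) :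
    ∀ D ∈ (Q.pos a).map (dom Q w m a), D.Nonempty := by
  intro D hD
  obtain ⟨v, _, rfl⟩ := List.mem_map.1 hD
  exact nonempty_dom hm hw a v

theorem lt_of_mem_dom {a : Fin Q.m} {v : Fin Q.n} {c : ℕ} (h : c ∈ dom Q w m a v) :
    c < m + w := by
  by_cases hv : (v : ℕ) = w
  · have := ((mem_dom_of_eq hv).1 h).1
    omega
  · rw [dom_of_ne hv, Finset.mem_range] at h
    omega

theorem pos_pair {a : Fin Q.m} {i v : Fin Q.n} (hi : i < v) (ha : Q.attrs a = {i, v}) :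
    Q.pos a = [i, v] := by
  rw [JoinQuery.pos, ha, Finset.sort_insert]
  · simp
  · intro b hb
    rw [Finset.mem_singleton.1 hb]
    exact hi.le
  · simpa using hi.ne

theorem gap_gridInstance (hm : 0 < m) (hw : 2 ≤ w) {t : List ℤ} {c : Pattern × Interval}
    (hc : c ∈ gapConstraints (gridInstance Q w m) t) :
    ∃ (a : Fin Q.m) (j : ℕ) (h : j < (Q.pos a).length) (p : List ℕ) (x : ℤ), p.length = j ∧
      (∀ d ∈ p, d < m + w) ∧
      children ((gridInstance Q w m).rel a) p = dom Q w m a (Q.pos a)[j] ∧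
      c = (gapPattern ((Q.pos a).map Fin.val) p ((Q.pos a)[j] : Fin Q.n),
          gapInterval ((gridInstance Q w m).rel a) p x) := by
  obtain ⟨a, j, hj, p, hp, rfl⟩ := mem_gapConstraints.1 hc
  have hne := nonempty_of_mem_map_dom (Q := Q) hm hw a
  obtain ⟨h1, h2⟩ := mem_exploredNodes_prodRel hne (by simpa using hj.le) hp
  refine ⟨a, j, hj, p, _, h1, fun d hd => ?_, ?_, rfl⟩
  · obtain ⟨i, hi, rfl⟩ := List.mem_iff_getElem.1 hd
    have h3 := h2.get hi (by rw [← h2.length_eq]; exact hi)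
    simp only [List.get_eq_getElem, List.getElem_take, List.getElem_map] at h3
    exact lt_of_mem_dom h3
  · simp only [gridInstance]
    rw [children_prodRel hne h2 (by simpa [h1] using hj)]
    simp [h1]

/-- In the sorted attribute list, an attribute before `s[j]` has a position below `j`, so the path
`p` of length `j` assigns it a value. -/
theorem lookup_ne_none {s : List (Fin Q.n)} (hs : s.Pairwise (· < ·)) {j : ℕ} (hj : j < s.length)
    {p : List ℕ} (hp : p.length = j) {i : Fin Q.n} (hi : i ∈ s) (hij : i < s[j]) :
    ((s.map Fin.val).zip p).lookup (i : ℕ) ≠ none := by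
  obtain ⟨k, hk, rfl⟩ := List.mem_iff_getElem.1 hi
  have hkj : k < j := by
    by_contra h
    rcases (not_lt.1 h).eq_or_lt with rfl | h
    · exact lt_irrefl _ hij
    · exact lt_asymm hij (List.pairwise_iff_getElem.1 hs _ _ hj hk h)
  intro h
  rw [List.lookup_eq_none_iff] at h
  have := h (s[k].val, p[k]'(by omega)) (List.mem_iff_getElem.2 ⟨k, by simp; omega, by simp⟩)
  simp at this

/-- On the last attribute only the atom `{i, v}` misses `i`, and the path to its gap fixes attribute
`i`. On an earlier attribute every node has all the children `0, …, m - 1`, so no gap covers a grid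
value. Hence the gaps alone exclude no grid point. -/
theorem derived_gap (hm : 0 < m) (hw : 2 ≤ w) {t : List ℤ} {c : Pattern × Interval}
    (hc : c ∈ gapConstraints (gridInstance Q w m) t) {v : ℤ} (hv : c.2.Mem v) :
    Derived (∅ : Finset (Fin w → Fin m)) c.1 v := by
  obtain ⟨a, j, hj, p, x, h1, h2, h3, rfl⟩ := gap_gridInstance hm hw hc
  refine ⟨fun hl i hi hvi hn => ?_, fun hl d hd hvd => ?_⟩
  · subst hvi
    rw [length_gapPattern] at hl
    have h4 := notMem_of_mem_gapInterval hv
    rw [h3, mem_dom_of_eq hl] at h4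
    push Not at h4
    obtain ⟨k, rfl, hk'⟩ := h4 hi
    rw [getElem?_gapPattern (by omega)] at hn
    have h5 := Option.map_eq_none_iff.1 (Option.some.inj hn)
    have hs : (Q.pos a).Pairwise (· < ·) := (Finset.sortedLT_sort _).pairwise
    have hk : k ∈ Q.pos a := (Finset.mem_sort _).2 (by rw [hk']; simp)
    exact lookup_ne_none hs hj h1 hk (Fin.lt_def.2 (by omega)) h5
  · subst hvd
    rw [length_gapPattern] at hl
    have h4 := notMem_of_mem_gapInterval hv
    rw [h3, dom_of_ne (by omega), Finset.mem_range] at h4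
    exact absurd hd h4

theorem below_gap (hm : 0 < m) (hw : 2 ≤ w) {t : List ℤ} {c : Pattern × Interval}
    (hc : c ∈ gapConstraints (gridInstance Q w m) t) :
    Below (m + w : ℕ) c.1 ∧ ∀ r : ℤ, c.2.hi = r → r ≤ (m + w : ℕ) + 1 := by
  obtain ⟨a, j, hj, p, x, h1, h2, h3, rfl⟩ := gap_gridInstance hm hw hc
  refine ⟨fun d hd => ?_, fun r hr => ?_⟩
  · simp only [gapPattern, List.mem_map, Option.map_eq_some_iff] at hd
    obtain ⟨_, _, e, he, rfl⟩ := hd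
    have := h2 e (mem_of_lookup he)
    omega
  · obtain ⟨e, he, rfl⟩ := hi_gapInterval hr
    rw [h3] at he
    have := lt_of_mem_dom he
    omega

variable (hn : Q.n = w + 1) {v : Fin Q.n} (hv : (v : ℕ) = w)
  (hpair : ∀ i : Fin Q.n, (i : ℕ) < w → ∃ a, Q.attrs a = {i, v})

section Pair

variable {a : Fin Q.m} {i : Fin Q.n} (hi : (i : ℕ) < w) (ha : Q.attrs a = {i, v})
include hv hi ha

theorem rel_gridInstance_pair : (gridInstance Q w m).rel a =
    prodRel [Finset.range m, (Finset.range w).erase i] := by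
  have : i < v := Fin.lt_def.2 (by omega)
  simp only [gridInstance, pos_pair this ha, List.map_cons, List.map_nil]
  rw [dom_of_ne (by omega), dom_pair hv hi ha]

theorem nonempty_pair (hm : 0 < m) (hw : 2 ≤ w) :
    ∀ D ∈ [Finset.range m, (Finset.range w).erase i], D.Nonempty := by
  intro D hD
  have h1 := nonempty_dom (Q := Q) hm hw a v
  rw [dom_pair hv hi ha] at h1
  simp only [List.mem_cons, List.not_mem_nil, or_false] at hD
  rcases hD with rfl | rfl
  · exact ⟨0, by simpa using hm⟩
  · exact h1

theorem children_pair_nil (hm : 0 < m) (hw : 2 ≤ w) :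
    children ((gridInstance Q w m).rel a) [] = Finset.range m := by
  rw [rel_gridInstance_pair hv hi ha,
    children_prodRel (nonempty_pair hv hi ha hm hw) (by simp) (by simp)]
  simp

theorem children_pair_singleton (hm : 0 < m) (hw : 2 ≤ w) {x : ℕ} (hx : x < m) :
    children ((gridInstance Q w m).rel a) [x] = (Finset.range w).erase i := by
  rw [rel_gridInstance_pair hv hi ha,
    children_prodRel (nonempty_pair hv hi ha hm hw) (by simpa using hx) (by simp)]
  simp

end Pair

include hv hpair

theorem output_gridInstance (hw : 0 < w) : (gridInstance Q w m).output = ∅ := by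
  refine Set.eq_empty_of_forall_notMem fun t ht => ?_
  have key : ∀ (i : Fin Q.n), (i : ℕ) < w → t v ∈ (Finset.range w).erase i := by
    intro i hi
    obtain ⟨a, ha⟩ := hpair i hi
    have h := ht a
    rw [rel_gridInstance_pair hv hi ha, pos_pair (Fin.lt_def.2 (by omega)) ha, mem_prodRel] at h
    simpa using (by simpa using h : _ ∧ _).2
  have hv' := v.2
  -- Any pair atom with `v` bounds the last coordinate by `w`; the atom that this coordinate itself
  -- names then refuses it.
  have h0 := key ⟨0, by omega⟩ hw
  have h1 : t v < w := by simpa using (Finset.mem_erase.1 h0).2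
  simpa using key ⟨t v, by omega⟩ h1

include hn

/-- If an earlier coordinate is off the grid, the gap at the root of a pair relation contains it.
Otherwise some pair relation misses the last coordinate. -/
theorem exists_gap_gridInstance (hm : 0 < m) (hw : 2 ≤ w) {t : List ℤ} (ht : t.length = Q.n) :
    ∃ c ∈ gapConstraints (gridInstance Q w m) t, CDS.RulesOut c.1 c.2 t := by
  have hget : ∀ i : Fin Q.n, t[(i : ℕ)]? = some (t.getD (i : ℕ) 0) := by
    intro i
    simp [ht]
  by_cases h : ∃ i : Fin Q.n, (i : ℕ) < w ∧ ∀ c ∈ Finset.range m, (c : ℤ) ≠ t.getD (i : ℕ) 0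
  · obtain ⟨i, hi, hti⟩ := h
    obtain ⟨a, ha⟩ := hpair i hi
    have hpos := pos_pair (Fin.lt_def.2 (by omega)) ha
    have hj : 0 < (Q.pos a).length := by simp [hpos]
    have hp0 : (Q.pos a)[0] = i := by simp [hpos]
    refine ⟨_, mem_gapConstraints.2 ⟨a, 0, hj, [], by simp [exploredNodes], rfl⟩, ?_⟩
    rw [hp0]
    refine ⟨t.getD i 0, specializes_gapPattern (by omega) (by simp), ?_, mem_gapInterval ?_⟩
    · rw [length_gapPattern]; exact hget i
    · rw [children_pair_nil hv hi ha hm hw]; exact hti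
  · push Not at h
    obtain ⟨i, hi, hti⟩ : ∃ i : Fin Q.n, (i : ℕ) < w ∧
        ∀ c ∈ (Finset.range w).erase i, (c : ℤ) ≠ t.getD (v : ℕ) 0 := by
      by_cases h' : ∃ c < w, (c : ℤ) = t.getD (v : ℕ) 0
      · obtain ⟨c, hc, hct⟩ := h'
        refine ⟨⟨c, by omega⟩, hc, fun d hd hdt => ?_⟩
        rw [Finset.mem_erase] at hd
        exact hd.1 (by rw [← hct] at hdt; exact_mod_cast hdt)
      · push Not at h'
        -- A last coordinate outside `{0, …, w - 1}` is missing from every pair relation, so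
        -- attribute `0` serves.
        refine ⟨⟨0, by omega⟩, by simp; omega, fun d hd => h' d ?_⟩
        simpa using (Finset.mem_erase.1 hd).2
    obtain ⟨a, ha⟩ := hpair i hi
    obtain ⟨x, hx, hxt⟩ := h i hi
    have hpos := pos_pair (Fin.lt_def.2 (by omega)) ha
    have hj : 1 < (Q.pos a).length := by simp [hpos]
    have hp1 : (Q.pos a)[1] = v := by simp [hpos]
    have hch := children_pair_nil (m := m) hv hi ha hm hw
    have hxm := Finset.mem_range.1 hx
    refine ⟨_, mem_gapConstraints.2 ⟨a, 1, hj, [x], ?_, rfl⟩, ?_⟩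
    · simp only [exploredNodes, List.mem_flatMap, List.mem_singleton, exists_eq_left]
      -- The coordinate `x` is itself a child of the root, so already the lower neighbour leads to
      -- the node `[x]`.
      refine List.mem_append_left _ ?_
      simp only [hpos, List.map_cons, List.getD_cons_zero]
      rw [← hxt, gapLo_of_mem (by rw [hch]; exact hx)]
      exact List.mem_singleton.2 rfl
    · rw [hp1]
      refine ⟨t.getD v 0, specializes_gapPattern (by omega) ?_, ?_, mem_gapInterval ?_⟩
      · intro k _ c hc
        rw [hpos, List.lookup_eq_some_iff] at hc
        obtain ⟨l₁, l₂, hc, _⟩ := hc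
        cases l₁ with
        | nil =>
          simp at hc
          rw [← hc.1.1, hget, ← hxt, hc.1.2]
        | cons b l₁ => simp at hc
      · rw [length_gapPattern]; exact hget v
      · rw [children_pair_singleton hv hi ha hm hw hxm]; exact hti

theorem exists_run_gridInstance (hm : 0 < m) (hw : 2 ≤ w) :
    ∃ out k, Run (gridInstance Q w m) out k :=
  Run.exists (output_gridInstance hv hpair (by omega)) (B := (m + w : ℕ)) (by omega)
    (fun _ _ hc => below_gap hm hw hc) fun _ ht => exists_gap_gridInstance hn hv hpair hm hw ht

theorem pow_le_of_run_gridInstance (hm : 0 < m) (hw : 2 ≤ w) {out : List (Fin Q.n → ℕ)} {k : ℕ}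
    (h : Run (gridInstance Q w m) out k) : m ^ w ≤ k :=
  Run.pow_le hm (by omega) hn (output_gridInstance hv hpair (by omega))
    (fun _ _ hc _ hv => derived_gap hm hw hc hv) h

end Grid

/-! ## Search trees -/

theorem children_congr {R R' : Finset (List ℕ)} {p : List ℕ}
    (h : ∀ r, p <+: r → (r ∈ R ↔ r ∈ R')) : children R p = children R' p := by
  ext c
  simp only [mem_children]
  have h' : ∀ r, p ++ [c] <+: r → (r ∈ R ↔ r ∈ R') := fun r hr =>
    h r ((List.prefix_append _ _).trans hr)
  exact ⟨fun ⟨r, hr, hp⟩ => ⟨r, (h' r hp).1 hr, hp⟩, fun ⟨r, hr, hp⟩ => ⟨r, (h' r hp).2 hr, hp⟩⟩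

theorem descend_cons_of_getElem? {R : Finset (List ℕ)} {p x : List ℕ} {i c : ℕ}
    (h : ((children R p).sort (· ≤ ·))[i]? = some c) :
    descend R p (i :: x) = descend R (p ++ [c]) x := by
  simp only [descend, h]

/-- Only tuples that extend `p` matter below the node `p`. -/
theorem descend_congr {R R' : Finset (List ℕ)} {p : List ℕ}
    (h : ∀ r, p <+: r → (r ∈ R ↔ r ∈ R')) (x : List ℕ) : descend R p x = descend R' p x := by
  induction x generalizing p with
  | nil => rfl
  | cons i x ih =>
    have h1 := children_congr h
    cases hc : ((children R' p).sort (· ≤ ·))[i]? with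
    | none => simp [descend, h1, hc]
    | some c =>
      rw [descend_cons_of_getElem? hc, descend_cons_of_getElem? (by rw [h1]; exact hc)]
      exact ih fun r hr => h r ((List.prefix_append _ _).trans hr)

theorem exists_of_descend_cons {R : Finset (List ℕ)} {p x l : List ℕ} {i : ℕ}
    (h : descend R p (i :: x) = some l) :
    ∃ c ∈ children R p, ((children R p).sort (· ≤ ·))[i]? = some c ∧ i < (children R p).card ∧
      descend R (p ++ [c]) x = some l := by
  cases hc : ((children R p).sort (· ≤ ·))[i]? with
  | none => simp [descend, hc] at h
  | some c =>
    rw [descend_cons_of_getElem? hc] at h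
    refine ⟨c, (Finset.mem_sort (· ≤ ·)).1 (List.mem_of_getElem? hc), rfl, ?_, h⟩
    have := (List.getElem?_eq_some_iff.1 hc).1
    rwa [Finset.length_sort] at this

theorem exists_getElem?_sort {s : Finset ℕ} {c : ℕ} (h : c ∈ s) :
    ∃ i < s.card, (s.sort (· ≤ ·))[i]? = some c := by
  obtain ⟨i, hi, rfl⟩ := List.mem_iff_getElem.1 ((Finset.mem_sort (· ≤ ·)).2 h)
  exact ⟨i, by rwa [Finset.length_sort] at hi, List.getElem?_eq_getElem hi⟩

theorem length_of_descend {R : Finset (List ℕ)} {p x l : List ℕ} (h : descend R p x = some l) :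
    l.length = p.length + x.length := by
  induction x generalizing p with
  | nil => simp only [descend, Option.some.injEq] at h; simp [h]
  | cons i x ih =>
    obtain ⟨c, _, _, _, h⟩ := exists_of_descend_cons h
    rw [ih h]
    simp
    omega

theorem exists_descend {R : Finset (List ℕ)} {r : List ℕ} (hr : r ∈ R) (s : List ℕ) :
    ∀ {p : List ℕ}, p ++ s = r → ∃ x, descend R p x = some r := by
  induction s with
  | nil => rintro p rfl; exact ⟨[], by simp [descend]⟩
  | cons c s ih =>
    intro p hp
    obtain ⟨i, _, hi⟩ := exists_getElem?_sort ((mem_children (p := p) (c := c)).2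
      ⟨r, hr, s, by simp [← hp]⟩)
    obtain ⟨x, hx⟩ := ih (p := p ++ [c]) (by simp [← hp])
    exact ⟨i :: x, by rw [descend_cons_of_getElem? hi, hx]⟩

theorem Instance.exists_isWitness {Q : JoinQuery} {I : Instance Q} {t : Fin Q.n → ℕ}
    (ht : t ∈ I.output) : ∃ X, I.IsWitness X := by
  have : ∀ a, ∃ x, I.values a x = some ((Q.pos a).map t) := fun a =>
    exists_descend (ht a) _ rfl
  choose X hX using this
  exact ⟨X, t, ht, hX⟩

theorem not_isWitness {Q : JoinQuery} {I : Instance Q} (h : I.output = ∅)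
    (X : Fin Q.m → List ℕ) : ¬ I.IsWitness X := by
  rintro ⟨t, ht, _⟩
  rw [h] at ht
  exact ht

/-! ## Certificates of the grid instances -/

section Grid

variable {Q : JoinQuery} {w m : ℕ} (hn : Q.n = w + 1) {v : Fin Q.n} (hv : (v : ℕ) = w)
  (hpair : ∀ i : Fin Q.n, (i : ℕ) < w → ∃ a, Q.attrs a = {i, v})

section Pair

variable {a : Fin Q.m} {i : Fin Q.n} (hi : (i : ℕ) < w) (ha : Q.attrs a = {i, v})
include hv hi ha

theorem values_pair (hm : 0 < m) (hw : 2 ≤ w) {x z : ℕ} {l : List ℕ}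
    (h : (gridInstance Q w m).values a [x, z] = some l) :
    x < m ∧ z < w ∧ ∃ c₀ c, l = [c₀, c] ∧ c ∈ (Finset.range w).erase i := by
  obtain ⟨c₀, h1, _, h2, h3⟩ := exists_of_descend_cons h
  rw [children_pair_nil hv hi ha hm hw, Finset.card_range] at h2
  rw [children_pair_nil hv hi ha hm hw, Finset.mem_range] at h1
  obtain ⟨c, h4, _, h5, h6⟩ := exists_of_descend_cons h3
  rw [List.nil_append, children_pair_singleton hv hi ha hm hw h1] at h4 h5
  refine ⟨h2, h5.trans_le ?_, c₀, c, ?_, h4⟩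
  · exact (Finset.card_erase_le).trans (Finset.card_range w).le
  · simpa [descend] using h6.symm

theorem exists_values_pair (hm : 0 < m) (hw : 2 ≤ w) {c : ℕ} (hc : c ∈ (Finset.range w).erase i) :
    ∃ z c₀, (gridInstance Q w m).values a [0, z] = some [c₀, c] := by
  have hch := children_pair_nil (m := m) hv hi ha hm hw
  obtain ⟨c₀, h1⟩ : ∃ c₀, ((children ((gridInstance Q w m).rel a) []).sort (· ≤ ·))[0]? = some c₀ :=
    ⟨_, List.getElem?_eq_getElem (by rw [Finset.length_sort, hch]; simpa using hm)⟩
  have h2 : c₀ < m := by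
    have := List.mem_of_getElem? h1
    rwa [Finset.mem_sort, hch, Finset.mem_range] at this
  have h3 := children_pair_singleton hv hi ha hm hw h2
  rw [← h3] at hc
  obtain ⟨z, _, hz⟩ := exists_getElem?_sort hc
  refine ⟨z, c₀, ?_⟩
  unfold Instance.values
  rw [descend_cons_of_getElem? h1, List.nil_append, descend_cons_of_getElem? hz]
  rfl

end Pair

include hv hpair

/-- The branches `0` serve as a common scale for the last attribute. In an instance obeying the
comparisons, suppose an output tuple uses in relation `0` a variable whose original value is `c`. In
relation `c` it uses a variable whose original value is some `c' ≠ c`. Both variables now have equal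
values, and comparing them with one reference variable of original value `c` gives `c' = c`. The
factor `w ^ 4` counts two relations and two positions. -/
theorem exists_isCertificate_gridInstance (hm : 0 < m) (hw : 2 ≤ w) :
    ∃ A, IsCertificate (gridInstance Q w m) A ∧ A.card ≤ w ^ 4 * m := by
  classical
  have hpair' : ∀ i : Fin w, ∃ a, Q.attrs a = {⟨i, by have := v.2; omega⟩, v} := fun i =>
    hpair ⟨i, by have := v.2; omega⟩ i.2
  choose a ha using hpair'
  set I := gridInstance Q w m with hI
  -- The default `0` is never used, because `S` keeps only index tuples that exist; a pair relation
  -- has just `w - 1` values below each branch.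
  let f : Fin w × Fin m × Fin w × Fin w × Fin w → Comparison Q := fun ⟨i, x, z, j, z'⟩ =>
    ⟨a i, [x, z], compare ((I.value (a i) [x, z]).getD 0) ((I.value (a j) [0, z']).getD 0),
      a j, [0, z']⟩
  let S : Finset (Fin w × Fin m × Fin w × Fin w × Fin w) := Finset.univ.filter fun y =>
    (I.values (a y.1) [y.2.1, y.2.2.1]).isSome ∧ (I.values (a y.2.2.2.1) [0, y.2.2.2.2]).isSome
  have hpos : ∀ i : Fin w, Q.pos (a i) = [⟨i, by have := v.2; omega⟩, v] := fun i =>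
    pos_pair (Fin.lt_def.2 (by have := i.2; simp; omega)) (ha i)
  have hval : ∀ (i : Fin w) (x z : ℕ), (I.values (a i) [x, z]).isSome →
      x < m ∧ z < w ∧ ∃ c₀ c, I.values (a i) [x, z] = some [c₀, c] ∧
        c ∈ (Finset.range w).erase i := by
    intro i x z h
    obtain ⟨l, hl⟩ := Option.isSome_iff_exists.1 h
    obtain ⟨h1, h2, c₀, c, rfl, hc⟩ := values_pair hv (i := ⟨i, by have := v.2; omega⟩) i.2 (ha i) hm hw hl
    exact ⟨h1, h2, c₀, c, hl, hc⟩
  have hval' : ∀ (J : Instance Q) (b : Fin Q.m) (x : List ℕ) (c₀ c : ℕ),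
      J.values b x = some [c₀, c] → J.value b x = some c := by
    intro J b x c₀ c h
    simp [Instance.value, h]
  refine ⟨S.image f, ⟨?_, ?_, ?_⟩, ?_⟩
  · intro c hc
    obtain ⟨⟨i, x, z, j, z'⟩, hy, rfl⟩ := Finset.mem_image.1 hc
    obtain ⟨h1, h2⟩ := (Finset.mem_filter.1 hy).2
    exact ⟨by simp [f], by simp [f], h1, h2, by simp [f, hpos]⟩
  · intro c hc
    obtain ⟨⟨i, x, z, j, z'⟩, hy, rfl⟩ := Finset.mem_image.1 hc
    obtain ⟨h1, h2⟩ := (Finset.mem_filter.1 hy).2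
    obtain ⟨_, _, c₀, c, h3, _⟩ := hval _ _ _ h1
    obtain ⟨_, _, d₀, d, h4, _⟩ := hval _ _ _ h2
    have h5 := hval' _ _ _ _ _ h3
    have h6 := hval' _ _ _ _ _ h4
    dsimp only at h5 h6
    exact ⟨c, d, h5, h6, by simp [f, h5, h6]⟩
  · have key : ∀ J : Instance Q, I.SameShape J → (∀ c ∈ S.image f, c.Holds J) →
        J.output = ∅ := by
      intro J hJ hA
      refine Set.eq_empty_of_forall_notMem fun t ht => ?_
      have hx : ∀ i : Fin w, ∃ (x : Fin m) (z : Fin w) (c₀ c : ℕ),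
          J.value (a i) [(x : ℕ), (z : ℕ)] = some (t v) ∧
          I.values (a i) [(x : ℕ), (z : ℕ)] = some [c₀, c] ∧ c ∈ (Finset.range w).erase i := by
        intro i
        have h1 := ht (a i)
        rw [hpos] at h1
        obtain ⟨X, hX⟩ := exists_descend h1 _ (p := []) rfl
        have h2 := length_of_descend hX
        obtain ⟨x, z, rfl⟩ := List.length_eq_two.1 (show X.length = 2 by simpa using h2.symm)
        have h3 : (J.values (a i) [x, z]).isSome := by
          unfold Instance.values; rw [hX]; rfl
        obtain ⟨h4, h5, c₀, c, h6, h7⟩ := hval i x z ((hJ _ _).2 h3)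
        exact ⟨⟨x, h4⟩, ⟨z, h5⟩, c₀, c, hval' J _ _ _ _ hX, h6, h7⟩
      have hcomp : ∀ (i j : Fin w) (x : Fin m) (z z' : Fin w) (c₀ c d₀ d u : ℕ),
          I.values (a i) [(x : ℕ), (z : ℕ)] = some [c₀, c] →
          I.values (a j) [0, (z' : ℕ)] = some [d₀, d] →
          J.value (a i) [(x : ℕ), (z : ℕ)] = some u →
          ∃ u', J.value (a j) [0, (z' : ℕ)] = some u' ∧ compare u u' = compare c d := by
        intro i j x z z' c₀ c d₀ d u h1 h2 h3
        obtain ⟨u₁, u', h4, h5, h6⟩ := hA (f (i, x, z, j, z')) (Finset.mem_image_of_mem _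
          (Finset.mem_filter.2 ⟨Finset.mem_univ _, by simp [h1], by simp [h2]⟩))
        dsimp only [f] at h4 h5 h6
        rw [h3] at h4
        cases h4
        refine ⟨u', h5, ?_⟩
        simpa [hval' _ _ _ _ _ h1, hval' _ _ _ _ _ h2] using h6
      obtain ⟨x, z, c₀, c, h1, h2, h3⟩ := hx ⟨0, by omega⟩
      rw [Finset.mem_erase, Finset.mem_range] at h3
      obtain ⟨x', z', c₀', c', h1', h2', h3'⟩ := hx ⟨c, h3.2⟩
      -- Relation `0` contains `c` because `c ≠ 0`; it provides the reference variable.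
      obtain ⟨j, hj⟩ : ∃ j : Fin w, c ≠ j := ⟨⟨0, by omega⟩, by simpa using h3.1⟩
      obtain ⟨y, d₀, hy⟩ := exists_values_pair hv (i := ⟨j, by have := v.2; omega⟩) j.2 (ha j)
        hm hw (c := c) (Finset.mem_erase.2 ⟨hj, Finset.mem_range.2 h3.2⟩)
      obtain ⟨_, hyw, _⟩ := hval j 0 y (by rw [hI, hy]; rfl)
      obtain ⟨u, h4, h5⟩ := hcomp _ j x z ⟨y, hyw⟩ _ _ _ _ _ h2 hy h1
      obtain ⟨u', h4', h5'⟩ := hcomp _ j x' z' ⟨y, hyw⟩ _ _ _ _ _ h2' hy h1'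
      rw [h4] at h4'
      cases h4'
      rw [compare_eq_iff_eq.2 rfl, compare_eq_iff_eq] at h5
      rw [h5, compare_eq_iff_eq.2 rfl, eq_comm, compare_eq_iff_eq] at h5'
      rw [h5'] at h3'
      simp at h3'
    intro J K hJ hK hAJ hAK X
    exact iff_of_false (not_isWitness (key J hJ hAJ) X) (not_isWitness (key K hK hAK) X)
  · refine Finset.card_image_le.trans ((Finset.card_filter_le _ _).trans (le_of_eq ?_))
    simp
    ring

/-- Each comparison mentions at most two top-level branches, so fewer than `m / 2` comparisons leave
some branch `k` untouched. Replacing the values below it by `0, …, w - 2` in all pair relations with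
`v` keeps the shape and all comparisons, but creates an output tuple. -/
theorem le_of_isCertificate_gridInstance (hw : 2 ≤ w) {A : Finset (Comparison Q)}
    (hA : IsCertificate (gridInstance Q w m) A) : m ≤ 2 * A.card := by
  classical
  by_contra hlt
  have hm : 0 < m := by omega
  set I := gridInstance Q w m with hI
  obtain ⟨k, hk, hkA⟩ : ∃ k ∈ Finset.range m,
      k ∉ A.image (fun c => c.x.headD 0) ∪ A.image (fun c => c.y.headD 0) := by
    refine Finset.exists_mem_notMem_of_card_lt_card ?_
    refine (Finset.card_union_le _ _).trans_lt ?_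
    have h1 := Finset.card_image_le (s := A) (f := fun c => c.x.headD 0)
    have h2 := Finset.card_image_le (s := A) (f := fun c => c.y.headD 0)
    rw [Finset.card_range]
    omega
  have hkl : k < ((Finset.range m).sort (· ≤ ·)).length := by
    rw [Finset.length_sort, Finset.card_range]; exact Finset.mem_range.1 hk
  -- The value `e` is the label of branch `k`.
  obtain ⟨e, he⟩ : ∃ e, ((Finset.range m).sort (· ≤ ·))[k]? = some e :=
    ⟨_, List.getElem?_eq_getElem hkl⟩
  have hem : e < m := by
    have := List.mem_of_getElem? he
    rwa [Finset.mem_sort, Finset.mem_range] at this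
  have hidx : ∀ j, ((Finset.range m).sort (· ≤ ·))[j]? = some e → j = k := by
    intro j hj
    have h1 : j < ((Finset.range m).sort (· ≤ ·)).length := (List.getElem?_eq_some_iff.1 hj).1
    exact (List.getElem?_inj h1 (Finset.sort_nodup _ _)).1 (hj.trans he.symm)
  let P : Fin Q.m → Prop := fun a => ∃ i : Fin Q.n, (i : ℕ) < w ∧ Q.attrs a = {i, v}
  -- The original branch has `w - 1` children, and so does the new one; the value `0` is now common
  -- to all these relations.
  let rel : Fin Q.m → Finset (List ℕ) := fun a =>
    if P a then (I.rel a).filter (fun r => ¬ [e] <+: r) ∪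
      (Finset.range (w - 1)).image (fun y => [e, y]) else I.rel a
  let J : Instance Q := ⟨rel, by
    intro a r hr
    simp only [rel] at hr
    split_ifs at hr with hP
    · rcases Finset.mem_union.1 hr with hr | hr
      · exact I.rel_length a r (Finset.mem_filter.1 hr).1
      · obtain ⟨y, _, rfl⟩ := Finset.mem_image.1 hr
        obtain ⟨i, hi, ha⟩ := hP
        rw [ha, Finset.card_pair (by rintro rfl; omega)]
        rfl
    · exact I.rel_length a r hr⟩
  have hJ : ∀ a, P a → ∀ r, r ∈ J.rel a ↔
      (r ∈ I.rel a ∧ ¬ [e] <+: r) ∨ ∃ y < w - 1, [e, y] = r := by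
    intro a ha r
    simp [J, rel, ha]
  have hJ' : ∀ a, ¬ P a → J.rel a = I.rel a := fun a ha => if_neg ha
  have hlen : ∀ a, P a → ∀ r ∈ I.rel a, r.length = 2 := by
    rintro a ⟨i, hi, ha⟩ r hr
    rw [I.rel_length a r hr, ha, Finset.card_pair (by rintro rfl; omega)]
  have hnil : ∀ a, P a → children (I.rel a) [] = Finset.range m := by
    rintro a ⟨i, hi, ha⟩
    exact children_pair_nil hv hi ha hm hw
  have hnil' : ∀ a, P a → children (J.rel a) [] = Finset.range m := by
    intro a ha
    rw [← hnil a ha]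
    ext c
    rw [mem_children, mem_children]
    constructor
    · rintro ⟨r, hr, hp⟩
      rcases (hJ a ha r).1 hr with ⟨hr, _⟩ | ⟨y, _, rfl⟩
      · exact ⟨r, hr, hp⟩
      · have : e ∈ children (I.rel a) [] := by rw [hnil a ha]; exact Finset.mem_range.2 hem
        rw [mem_children] at this
        simp only [List.nil_append, List.cons_prefix_cons, List.nil_prefix, and_true] at hp
        rwa [hp]
    · rintro ⟨r, hr, hp⟩
      by_cases hre : [e] <+: r
      · refine ⟨[e, 0], (hJ a ha _).2 (Or.inr ⟨0, by omega, rfl⟩), ?_⟩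
        rw [List.nil_append] at hp
        have := List.prefix_of_prefix_length_le hp hre (by simp)
        simp at this
        simp [this]
      · exact ⟨r, (hJ a ha r).2 (Or.inl ⟨hr, hre⟩), hp⟩
  have hchild : ∀ a, P a → (children (I.rel a) [e]).card = w - 1 := by
    rintro a ⟨i, hi, ha⟩
    rw [hI, children_pair_singleton hv hi ha hm hw hem,
      Finset.card_erase_of_mem (Finset.mem_range.2 hi), Finset.card_range]
  have hchild' : ∀ a, P a → (children (J.rel a) [e]).card = w - 1 := by
    intro a ha
    have : children (J.rel a) [e] = Finset.range (w - 1) := by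
      ext c
      rw [mem_children, Finset.mem_range]
      constructor
      · rintro ⟨r, hr, hp⟩
        rcases (hJ a ha r).1 hr with ⟨_, hr⟩ | ⟨y, hy, rfl⟩
        · exact absurd ((List.prefix_append _ _).trans hp) hr
        · simp at hp
          omega
      · intro hc
        exact ⟨[e, c], (hJ a ha _).2 (Or.inr ⟨c, hc, rfl⟩), by simp⟩
    rw [this, Finset.card_range]
  have hleaf : ∀ (R : Finset (List ℕ)) (p x : List ℕ) (i : ℕ), (∀ r ∈ R, r.length = 2) →
      p.length = 2 → descend R p (i :: x) = none := by
    intro R p x i hR hp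
    have : children R p = ∅ := by
      refine Finset.eq_empty_of_forall_notMem fun c hc => ?_
      obtain ⟨r, hr, hpr⟩ := mem_children.1 hc
      have h1 := hpr.length_le
      rw [hR r hr] at h1
      simp at h1
      omega
    simp [descend, this]
  have hbranch : ∀ (R : Finset (List ℕ)) (x : List ℕ), (∀ r ∈ R, r.length = 2) →
      (children R [e]).card = w - 1 →
      ((descend R [e] x).isSome ↔ x = [] ∨ ∃ z < w - 1, x = [z]) := by
    intro R x hR hc
    rcases x with _ | ⟨z, _ | ⟨z', x⟩⟩
    · simp [descend]
    · simp only [List.cons_ne_nil, List.cons.injEq, and_true, false_or, exists_eq_right']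
      constructor
      · intro h
        obtain ⟨l, hl⟩ := Option.isSome_iff_exists.1 h
        obtain ⟨_, _, _, h, _⟩ := exists_of_descend_cons hl
        rwa [hc] at h
      · intro h
        have : ((children R [e]).sort (· ≤ ·))[z]? = some (((children R [e]).sort (· ≤ ·))[z]'(by
          rwa [Finset.length_sort, hc])) := List.getElem?_eq_getElem _
        rw [descend_cons_of_getElem? this]
        rfl
    · refine iff_of_false (fun h => ?_) (by simp)
      obtain ⟨l, hl⟩ := Option.isSome_iff_exists.1 h
      obtain ⟨c, _, _, _, h⟩ := exists_of_descend_cons hl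
      rw [hleaf R _ _ _ hR (by simp)] at h
      simp at h
  -- The default `k` makes the first alternative fail for the empty index tuple, which is admitted
  -- separately.
  have hvals : ∀ a x, x.headD k ≠ k ∨ x = [] → J.values a x = I.values a x := by
    intro a x hx
    unfold Instance.values
    by_cases ha : P a
    · rcases x with _ | ⟨j, x⟩
      · rfl
      · have hj : j ≠ k := by simpa using hx
        cases hc : ((Finset.range m).sort (· ≤ ·))[j]? with
        | none => simp only [descend, hnil a ha, hnil' a ha, hc]
        | some c =>
          rw [descend_cons_of_getElem? (by rw [hnil' a ha]; exact hc),
            descend_cons_of_getElem? (by rw [hnil a ha]; exact hc)]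
          refine descend_congr (fun r hr => ?_) x
          have hce : c ≠ e := by rintro rfl; exact hj (hidx j hc)
          have hre : ¬ [e] <+: r := by
            intro h
            have := List.prefix_of_prefix_length_le h hr (by simp)
            simp at this
            exact hce this.symm
          rw [hJ a ha]
          constructor
          · rintro (⟨h, _⟩ | ⟨y, _, rfl⟩)
            · exact h
            · exact absurd (by simp) hre
          · exact fun h => Or.inl ⟨h, hre⟩
    · rw [hJ' a ha]
  have hshape : I.SameShape J := by
    intro a x
    by_cases hx : x.headD k ≠ k ∨ x = []
    · rw [hvals a x hx]
    · push Not at hx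
      by_cases ha : P a
      · rcases x with _ | ⟨j, x⟩
        · simp at hx
        · have hj : j = k := by simpa using hx.1
          subst hj
          unfold Instance.values
          rw [descend_cons_of_getElem? (by rw [hnil a ha]; exact he),
            descend_cons_of_getElem? (by rw [hnil' a ha]; exact he), List.nil_append,
            hbranch _ _ (hlen a ha) (hchild a ha), hbranch _ _ ?_ (hchild' a ha)]
          intro r hr
          rcases (hJ a ha r).1 hr with ⟨h, _⟩ | ⟨y, _, rfl⟩
          · exact hlen a ha r h
          · rfl
      · unfold Instance.values
        rw [hJ' a ha]
  have hholds : ∀ c ∈ A, c.Holds J := by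
    intro c hc
    obtain ⟨u, u', h1, h2, h3⟩ := hA.2.1 c hc
    obtain ⟨hx, hy, _⟩ := hA.1 c hc
    rw [Finset.mem_union, Finset.mem_image, Finset.mem_image] at hkA
    push Not at hkA
    have hx' : J.value c.a c.x = I.value c.a c.x := by
      unfold Instance.value
      rw [hvals]
      left
      have := hkA.1 c hc
      cases hcx : c.x with
      | nil => exact absurd hcx hx
      | cons b x => simpa [hcx] using this
    have hy' : J.value c.b c.y = I.value c.b c.y := by
      unfold Instance.value
      rw [hvals]
      left
      have := hkA.2 c hc
      cases hcy : c.y with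
      | nil => exact absurd hcy hy
      | cons b y => simpa [hcy] using this
    exact ⟨u, u', hx'.trans h1, hy'.trans h2, h3⟩
  -- The tuple is `e` everywhere except for `0` at `v`. The unchanged relations contain it since
  -- only atoms `{i, v}` miss a value.
  have hout : (fun u => if u = v then 0 else e) ∈ J.output := by
    intro a
    by_cases ha : P a
    · have hP := ha
      obtain ⟨i, hi, ha'⟩ := hP
      rw [hJ a ha, pos_pair (Fin.lt_def.2 (by omega)) ha']
      have hiv : i ≠ v := by rintro rfl; omega
      exact Or.inr ⟨0, by omega, by simp [hiv]⟩
    · rw [hJ' a ha]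
      refine mem_prodRel.2 ?_
      rw [List.forall₂_map_left_iff, List.forall₂_map_right_iff, List.forall₂_same]
      intro u _
      by_cases hu : u = v
      · subst hu
        rw [if_pos rfl, mem_dom_of_eq hv]
        exact ⟨by omega, fun i hi hai => ha ⟨i, by omega, hai⟩⟩
      · rw [if_neg hu, dom_of_ne (fun h => hu (Fin.ext (by omega)))]
        exact Finset.mem_range.2 hem
  obtain ⟨X, hX⟩ := Instance.exists_isWitness hout
  exact not_isWitness (output_gridInstance hv hpair (by omega)) X
    ((hA.2.2 I J (fun _ _ => Iff.rfl) hshape hA.2.1 hholds X).2 hX)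

theorem certSize_gridInstance (hm : 0 < m) (hw : 2 ≤ w) :
    m ≤ 2 * (gridInstance Q w m).certSize ∧ (gridInstance Q w m).certSize ≤ w ^ 4 * m := by
  obtain ⟨A, hA, hcard⟩ := exists_isCertificate_gridInstance hv hpair hm hw
  have hne : {k | ∃ A, IsCertificate (gridInstance Q w m) A ∧ A.card = k}.Nonempty :=
    ⟨_, A, hA, rfl⟩
  obtain ⟨A', hA', h'⟩ := Nat.sInf_mem hne
  refine ⟨?_, le_trans (Nat.sInf_le (show A.card ∈ _ from ⟨A, hA, rfl⟩)) hcard⟩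
  have := le_of_isCertificate_gridInstance hv hpair hw hA'
  rw [h'] at this
  exact this

/-! ### Size of the grid instances -/

include hn

omit hpair in
theorem inputSize_gridInstance_le (hm : 0 < m) :
    (gridInstance Q w m).inputSize ≤ Q.m * (m + w) ^ (w + 1) := by
  have : ∀ a ∈ (Finset.univ : Finset (Fin Q.m)),
      ((gridInstance Q w m).rel a).card ≤ (m + w) ^ (w + 1) := by
    intro a _
    simp only [gridInstance, card_prodRel]
    refine (List.prod_le_pow_card _ (m + w) ?_).trans ?_
    · intro x hx
      simp only [List.map_map, List.mem_map, Function.comp_apply] at hx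
      obtain ⟨u, _, rfl⟩ := hx
      have : dom Q w m a u ⊆ Finset.range (m + w) := fun c hc =>
        Finset.mem_range.2 (lt_of_mem_dom hc)
      simpa using Finset.card_le_card this
    · refine Nat.pow_le_pow_right (by omega) ?_
      rw [List.length_map, List.length_map, JoinQuery.pos, Finset.length_sort]
      simpa [hn] using Finset.card_le_univ (Q.attrs a)
  simpa [Instance.inputSize] using Finset.sum_le_sum this

theorem le_inputSize_gridInstance (hw : 2 ≤ w) : m ≤ (gridInstance Q w m).inputSize := by
  obtain ⟨a, ha⟩ := hpair ⟨0, by omega⟩ (by simp; omega)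
  have h1 : ((gridInstance Q w m).rel a).card ≤ (gridInstance Q w m).inputSize :=
    Finset.single_le_sum (f := fun a => ((gridInstance Q w m).rel a).card)
      (fun _ _ => Nat.zero_le _) (Finset.mem_univ a)
  refine le_trans ?_ h1
  rw [rel_gridInstance_pair hv (by simp; omega) ha, card_prodRel]
  have : ((Finset.range w).erase 0).card = w - 1 := by
    rw [Finset.card_erase_of_mem (by simp; omega), Finset.card_range]
  simp only [List.map_cons, List.map_nil, List.prod_cons, List.prod_nil, this, Finset.card_range,
    mul_one]
  exact Nat.le_mul_of_pos_right _ (by omega)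

end Grid

/-! ## The query -/

/-- The query on `w + 1` attributes whose atoms are all pairs of attributes, and one atom with all
attributes. -/
noncomputable def pairQuery (w : ℕ) : JoinQuery where
  n := w + 1
  m := Fintype.card {s : Finset (Fin (w + 1)) // s.card = 2 ∨ s = Finset.univ}
  attrs a := ((Fintype.equivFin _).symm a).1
  attrs_nonempty a := by
    rcases ((Fintype.equivFin _).symm a).2 with h | h
    · exact Finset.card_pos.1 (by omega)
    · rw [h]; exact Finset.univ_nonempty
  covered v := ⟨Fintype.equivFin _ ⟨Finset.univ, Or.inr rfl⟩, by simp⟩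

theorem exists_attrs_pairQuery {w : ℕ} {s : Finset (Fin (w + 1))}
    (hs : s.card = 2 ∨ s = Finset.univ) : ∃ a, (pairQuery w).attrs a = s := by
  let E := Fintype.equivFin {s : Finset (Fin (w + 1)) // s.card = 2 ∨ s = Finset.univ}
  exact ⟨E ⟨s, hs⟩, congrArg Subtype.val (E.symm_apply_apply ⟨s, hs⟩)⟩

/-- The tree decomposition with a single bag. -/
def TreeDecomposition.single (Q : JoinQuery) : TreeDecomposition Q where
  size := 1
  tree := ⊥
  isTree := SimpleGraph.IsTree.of_subsingleton
  bag _ := Finset.univ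
  edge_subset _ := ⟨0, Finset.subset_univ _⟩
  connected v := by
    have : Nonempty {s : Fin 1 | v ∈ (Finset.univ : Finset (Fin Q.n))} := ⟨⟨0, by simp⟩⟩
    exact (SimpleGraph.IsTree.of_subsingleton).1

theorem alphaAcyclic_pairQuery (w : ℕ) : (pairQuery w).AlphaAcyclic := by
  refine ⟨TreeDecomposition.single _, fun s => ?_⟩
  obtain ⟨a, ha⟩ := exists_attrs_pairQuery (w := w) (Or.inr rfl)
  exact ⟨a, ha.symm⟩

/-- Some bag must contain the full atom, which has `w + 1` attributes; a single bag attains this. -/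
theorem treewidth_pairQuery (w : ℕ) : (pairQuery w).treewidth = w := by
  have hw : w ∈ {k | ∃ D : TreeDecomposition (pairQuery w), ∀ s, (D.bag s).card ≤ k + 1} :=
    ⟨TreeDecomposition.single _, fun s => by simp [TreeDecomposition.single, pairQuery]⟩
  refine le_antisymm (Nat.sInf_le hw) (le_csInf ⟨w, hw⟩ ?_)
  rintro k ⟨D, hD⟩
  obtain ⟨a, ha⟩ := exists_attrs_pairQuery (w := w) (Or.inr rfl)
  obtain ⟨s, hs⟩ := D.edge_subset a
  have h1 := Finset.card_le_card hs
  rw [ha] at h1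
  have h2 : (Finset.univ : Finset (Fin (w + 1))).card = w + 1 := by simp
  have h3 := hD s
  have h4 := h2.symm.trans_le (h1.trans h3)
  omega

theorem map_pair_symm {k : ℕ} (σ : Equiv.Perm (Fin k)) (i v : Fin k) :
    ({σ.symm i, σ.symm v} : Finset (Fin k)).map σ.toEmbedding = {i, v} := by
  simp [Finset.map_insert]

/-- All pairs are atoms, so renaming attributes changes nothing. This is what makes the bound hold
for every attribute order. -/
theorem exists_attrs_reorder_pairQuery {w : ℕ} (σ : Equiv.Perm (Fin (pairQuery w).n))
    {i v : Fin ((pairQuery w).reorder σ).n} (h : i ≠ v) :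
    ∃ a, ((pairQuery w).reorder σ).attrs a = {i, v} := by
  obtain ⟨a, ha⟩ := exists_attrs_pairQuery (w := w) (s := {σ.symm i, σ.symm v})
    (Or.inl (Finset.card_pair (fun h' => h (σ.symm.injective h'))))
  refine ⟨a, ?_⟩
  show ((pairQuery w).attrs a).map σ.toEmbedding = _
  rw [ha]
  exact map_pair_symm σ i v

/-! ## Asymptotics -/

/-- If `m ^ w` is at most of order `(C m) ^ e`, up to powers of `log (N m)`, where `C m` is of order
`m` and `N m` is polynomial in `m`, then `w ≤ e`. -/
theorem le_exponent {w κ M : ℕ} {e b K : ℝ} {C N : ℕ → ℕ}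
    (hC : ∀ m, 2 ≤ m → m ≤ 2 * C m) (hC' : ∀ m, 2 ≤ m → C m ≤ κ * m)
    (hN : ∀ m, 2 ≤ m → m ≤ N m) (hN' : ∀ m, 2 ≤ m → N m ≤ M * (m + w) ^ (w + 1))
    (h : ∀ m : ℕ, 2 ≤ m → (m : ℝ) ^ w ≤ K * (C m : ℝ) ^ e * Real.log (N m) ^ b) : (w : ℝ) ≤ e := by
  by_contra hlt
  set δ : ℝ := w - e with hδ
  have hδ0 : 0 < δ := by rw [hδ]; linarith
  -- Once `m` is at least `w` and `M`, the input size is at most `m * (m ^ 2) ^ (w + 1) = m ^ R`.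
  set R : ℝ := 2 * w + 3 with hR
  have hR1 : 1 ≤ R := by
    have : (0 : ℝ) ≤ w := Nat.cast_nonneg w
    linarith
  set A : ℝ := |K| * (κ : ℝ) ^ w * 2 ^ δ * R ^ |b| with hA
  have hA0 : 0 ≤ A := by positivity
  have key : ∀ m : ℕ, 2 ≤ m → w ≤ m → M ≤ m → (m : ℝ) ^ δ ≤ A * Real.log m ^ b := by
    intro m hm hwm hMm
    have hm2 : (2 : ℝ) ≤ m := by exact_mod_cast hm
    have hm0 : (0 : ℝ) < m := by linarith
    have hlog : 0 < Real.log m := Real.log_pos (by linarith)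
    have hC1 : (m : ℝ) / 2 ≤ C m := by
      have : (m : ℝ) ≤ 2 * C m := by exact_mod_cast hC m hm
      linarith
    have hC0 : (0 : ℝ) < C m := by linarith
    have hC2 : (C m : ℝ) ≤ κ * m := by exact_mod_cast hC' m hm
    have hN1 : (m : ℝ) ≤ N m := by exact_mod_cast hN m hm
    have hN2 : (N m : ℝ) ≤ (m : ℝ) ^ (2 * w + 3) := by
      have h1 : N m ≤ m ^ (2 * w + 3) := by
        refine (hN' m hm).trans ?_
        have h2 : m + w ≤ m ^ 2 := by nlinarith
        calc M * (m + w) ^ (w + 1) ≤ m * (m ^ 2) ^ (w + 1) :=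
              Nat.mul_le_mul hMm (Nat.pow_le_pow_left h2 _)
          _ = m ^ (2 * w + 3) := by ring
      exact_mod_cast h1
    have hL1 : Real.log m ≤ Real.log (N m) := Real.log_le_log hm0 hN1
    have hL2 : Real.log (N m) ≤ R * Real.log m := by
      have := Real.log_le_log (by linarith) hN2
      rw [Real.log_pow] at this
      rw [hR]
      push_cast at this
      exact this
    -- The ratio of the two logarithms lies in `[1, R]`; the exponent `|b|` covers both signs of
    -- `b`.
    have hLb : Real.log (N m) ^ b ≤ R ^ |b| * Real.log m ^ b := by
      have hρ : 1 ≤ Real.log (N m) / Real.log m := (one_le_div hlog).2 hL1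
      have hρ' : Real.log (N m) / Real.log m ≤ R := (div_le_iff₀ hlog).2 hL2
      have h1 : Real.log (N m) = (Real.log (N m) / Real.log m) * Real.log m := by
        field_simp
      rw [h1, Real.mul_rpow (by linarith) hlog.le]
      refine mul_le_mul_of_nonneg_right ?_ (Real.rpow_nonneg hlog.le _)
      exact (Real.rpow_le_rpow_of_exponent_le hρ (le_abs_self b)).trans
        (Real.rpow_le_rpow (by linarith) hρ' (abs_nonneg b))
    have hCe : (C m : ℝ) ^ e ≤ (κ : ℝ) ^ w * (m : ℝ) ^ w * (2 ^ δ * (m : ℝ) ^ (-δ)) := by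
      -- Splitting the exponent handles every sign of `e`: the upper bound on `C m` serves for the
      -- power `w`, the lower bound for the negative power `-δ`.
      have h1 : e = w + -δ := by rw [hδ]; ring
      rw [h1, Real.rpow_add hC0, Real.rpow_natCast]
      refine mul_le_mul ?_ ?_ (Real.rpow_nonneg hC0.le _) (by positivity)
      · rw [← mul_pow]
        exact pow_le_pow_left₀ hC0.le hC2 w
      · refine (Real.rpow_le_rpow_of_nonpos (by linarith) hC1 (by linarith)).trans (le_of_eq ?_)
        rw [Real.div_rpow hm0.le (by norm_num), Real.rpow_neg (by norm_num : (0 : ℝ) ≤ 2),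
          div_inv_eq_mul, mul_comm]
    have h1 : (m : ℝ) ^ w ≤ |K| * ((κ : ℝ) ^ w * (m : ℝ) ^ w * (2 ^ δ * (m : ℝ) ^ (-δ))) *
        (R ^ |b| * Real.log m ^ b) := by
      refine (h m hm).trans ?_
      refine mul_le_mul ?_ hLb (Real.rpow_nonneg (by linarith) _) (by positivity)
      exact mul_le_mul (le_abs_self K) hCe (Real.rpow_nonneg hC0.le _) (abs_nonneg K)
    have h2 : 0 < (m : ℝ) ^ w := by positivity
    have h3 : (m : ℝ) ^ w * 1 ≤ (m : ℝ) ^ w * (A * Real.log m ^ b * (m : ℝ) ^ (-δ)) := by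
      rw [hA, mul_one]
      refine h1.trans (le_of_eq (by ring))
    have h4 := le_of_mul_le_mul_left h3 h2
    rw [Real.rpow_neg hm0.le, ← div_eq_mul_inv, one_le_div (by positivity)] at h4
    exact h4
  -- Powers of the logarithm are negligible against `m ^ δ`. The factor `1 / (2 * (A + 1))` makes
  -- the product with `A` less than `1`, also if `A = 0`.
  have ho := (isLittleO_log_rpow_rpow_atTop b hδ0).comp_tendsto tendsto_natCast_atTop_atTop
  have hev := ho.def (show (0 : ℝ) < 1 / (2 * (A + 1)) by positivity)
  obtain ⟨m, hm, hm1⟩ := (hev.and (Filter.eventually_ge_atTop (2 + w + M))).exists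
  have hk := key m (by omega) (by omega) (by omega)
  have hm2 : (2 : ℝ) ≤ m := by exact_mod_cast (by omega : 2 ≤ m)
  have hlog : 0 ≤ Real.log m := Real.log_nonneg (by linarith)
  have hp : 0 < (m : ℝ) ^ δ := Real.rpow_pos_of_pos (by linarith) _
  simp only [Function.comp_apply, Real.norm_eq_abs] at hm
  rw [abs_of_nonneg (Real.rpow_nonneg hlog _), abs_of_pos hp] at hm
  have h5 : (m : ℝ) ^ δ ≤ A * (1 / (2 * (A + 1)) * (m : ℝ) ^ δ) :=
    hk.trans (mul_le_mul_of_nonneg_left hm hA0)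
  have h6 : A * (1 / (2 * (A + 1))) < 1 := by
    rw [mul_one_div, div_lt_one (by positivity)]
    linarith
  rw [← mul_assoc] at h5
  nlinarith

end Minesweeper

/-! ### The main theorem -/

open Minesweeper in
theorem mainTheorem8 (w : ℕ) (hw : 2 ≤ w) :
    ∃ Q : Minesweeper.JoinQuery, Q.AlphaAcyclic ∧ Q.treewidth = w ∧
      ∀ σ : Equiv.Perm (Fin Q.n),
        -- An infinite family of instances on which the running time is at least of order `|𝒞| ^ w`
        (∃ I : ℕ → Minesweeper.Instance (Q.reorder σ),
          Filter.Tendsto (fun i => (I i).certSize) Filter.atTop Filter.atTop ∧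
          (∀ i, (I i).output = ∅) ∧
          (∀ i, ∃ out k, Minesweeper.Run (I i) out k) ∧
          ∃ c : ℝ, 0 < c ∧ ∀ i out k, Minesweeper.Run (I i) out k →
            c * ((I i).certSize : ℝ) ^ w ≤ (k : ℝ)) ∧
        -- No bound with an exponent below `w` holds, even up to logarithmic factors
        (∀ e b K : ℝ,
          (∀ I : Minesweeper.Instance (Q.reorder σ), 1 ≤ I.certSize → 2 ≤ I.inputSize →
            ∀ out k, Minesweeper.Run I out k →
              (k : ℝ) ≤ K * ((I.certSize : ℝ) ^ e + (I.output.ncard : ℝ)) *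
                Real.log (I.inputSize : ℝ) ^ b) →
          (w : ℝ) ≤ e) := by
  refine ⟨pairQuery w, alphaAcyclic_pairQuery w, treewidth_pairQuery w, fun σ => ?_⟩
  set Q := (pairQuery w).reorder σ with hQ
  have hn : Q.n = w + 1 := rfl
  let v : Fin Q.n := ⟨w, by omega⟩
  have hv : (v : ℕ) = w := rfl
  have hpair : ∀ i : Fin Q.n, (i : ℕ) < w → ∃ a, Q.attrs a = {i, v} := fun i hi =>
    exists_attrs_reorder_pairQuery σ (by rintro rfl; omega)
  have hw0 : (0 : ℝ) < (w : ℝ) ^ 4 := by positivity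
  have hout : ∀ m, (gridInstance Q w m).output = ∅ := fun m =>
    output_gridInstance hv hpair (by omega)
  have hrun : ∀ m, 0 < m → ∃ out k, Run (gridInstance Q w m) out k := fun m hm =>
    exists_run_gridInstance hn hv hpair hm hw
  have hcert : ∀ m, 0 < m → m ≤ 2 * (gridInstance Q w m).certSize ∧
      (gridInstance Q w m).certSize ≤ w ^ 4 * m := fun m hm =>
    certSize_gridInstance hv hpair hm hw
  -- The shift by one keeps the grid nonempty. The constant comes from `|𝒞| ≤ w ^ 4 * m`, raised to
  -- the power `w`.
  refine ⟨⟨fun k => gridInstance Q w (k + 1), ?_, fun k => hout _, fun k => hrun _ (by omega),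
    1 / ((w : ℝ) ^ 4) ^ w, by positivity, fun k out t ht => ?_⟩, fun e b K h => ?_⟩
  · refine Filter.tendsto_atTop.2 fun b => ?_
    filter_upwards [Filter.eventually_ge_atTop (2 * b)] with k hk
    have := (hcert (k + 1) (by omega)).1
    omega
  · have h1 : (((k + 1 : ℕ) : ℝ)) ^ w ≤ t := by
      exact_mod_cast pow_le_of_run_gridInstance hn hv hpair (by omega) hw ht
    have h2 : ((gridInstance Q w (k + 1)).certSize : ℝ) ≤ (w : ℝ) ^ 4 * ((k + 1 : ℕ) : ℝ) := by
      exact_mod_cast (hcert (k + 1) (by omega)).2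
    refine le_trans ?_ h1
    rw [one_div, inv_mul_le_iff₀ (by positivity), ← mul_pow]
    exact pow_le_pow_left₀ (Nat.cast_nonneg _) h2 w
  · refine le_exponent (κ := w ^ 4) (M := Q.m) (K := K) (b := b)
      (C := fun m => (gridInstance Q w m).certSize) (N := fun m => (gridInstance Q w m).inputSize)
      (fun m hm => (hcert m (by omega)).1) (fun m hm => (hcert m (by omega)).2)
      (fun m _ => le_inputSize_gridInstance hn hv hpair hw)
      (fun m hm => inputSize_gridInstance_le hn hv (by omega)) fun m hm => ?_
    obtain ⟨out, k, hk⟩ := hrun m (by omega)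
    have h1 : (m : ℝ) ^ w ≤ k := by
      exact_mod_cast pow_le_of_run_gridInstance hn hv hpair (by omega) hw hk
    have h2 := h _ (by have := (hcert m (by omega)).1; omega)
      (hm.trans (le_inputSize_gridInstance hn hv hpair hw)) out k hk
    rw [hout, Set.ncard_empty, Nat.cast_zero, add_zero] at h2
    exact h1.trans h2
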